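/- **Setting.** Let $n,k\ge 1$, $d\ge 2$, let $u\in\mathbb R^d$ satisfy $\|u\|_2=1$ and have support $S=\{i:u_i\neq 0\}$ with $|S|\le k$, let $0<\theta\le 1$, and let $\mathbf X\in\mathbb R^{n\times d}$ have i.i.d. rows distributed as $\mathcal N(0,I_d+\theta uu^\top)$. Write $\mathbf X_i$ for the $i$-th column and $\mathbf X_{-i}\in\mathbb R^{n\times(d-1)}$ for $\mathbf X$ with that column deleted. **Black box.** For $\mathbb X\in\mathbb R^{n\times p}$ let $\gamma(\mathbb X)$ be the largest $\gamma\ge 0$ such that $\frac1n\|\mathbb X\beta\|_2^2\ge\gamma\|\beta\|_2^2$ for all $\beta\in\mathbb R^p$ for which some $A\subseteq[p]$ with $|A|=k$ satisfies $\|\beta_{A^c}\|_1\le 3\|\beta_A\|_1$. A solver for sparse linear regression is a measurable map $(y,\mathbb X,k)\mapsto \mathsf{SLR}(y,\mathbb X,k)\in\mathbb R^p$, for $y\in\mathbb R^n$, with $k$-sparse output. It satisfies the black-box condition with constants $c,c',c''>0$ if, for all $n\ge 1$, $p\ge 2$, $1\le k\le p$, all fixed $\mathbb X\in\mathbb R^{n\times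 p}$ with $\gamma(\mathbb X)>0$, all $k$-sparse $\beta^\ast\in\mathbb R^p$ and all $\sigma>0$, the output $\widehat\beta=\mathsf{SLR}(\mathbb X\beta^\ast+w,\mathbb X,k)$ with $w\sim\mathcal N(0,\sigma^2I_n)$ satisfies $$\frac1n\|\mathbb X\widehat\beta-\mathbb X\beta^\ast\|_2^2\le\frac{c}{\min(\gamma(\mathbb X),1)^2}\cdot\frac{\sigma^2k\log p}{n}\quad\text{with probability at least }1-c'\exp(-c''k\log p).$$ **Algorithm ($Q$-support recovery).** For $i=1,\dots,d$ put $\widehat\beta_i=\mathsf{SLR}(\mathbf X_i,\mathbf X_{-i},k)$ and $Q_i=\frac1n\|\mathbf X_i\|_2^2-\frac1n\|\mathbf X_i-\mathbf X_{-i}\widehat\beta_i\|_2^2$. Return $\widehat S=\{i: Q_i>\frac{13k\log(d/k)}{n}\}$. **Theorem (Support recovery).** For all $c,c',c''>0$ there are constants $c_1,c_2,c_3,c_4>0$, depending only on $c,c',c''$, such that the following holds for every solver that satisfies the black-box condition with constants $c,c',c''$ and for all $n,d,k,\theta,u$ as above. Let $0<c_{\min}<1$ and suppose that - $c_{\min}^2/k\le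 u_i^2\le 1-c_{\min}^2/k$ for at least one $i\in[d]$; - $|u_i|\ge c_{\min}/\sqrt k$ for every $i\in S$; - $d/k\ge e$, and $k\le d^{1-\varepsilon}$ for some $\varepsilon>0$; - $n>c_2k\log d$ and $\theta^2>\frac{c_1}{c_{\min}^2}\cdot\frac{k^2\log d}{n}$. Then $\widehat S=S$ with probability at least $1-c_3\exp(-c_4\,\varepsilon\,k\log d)$. Moreover, if each call of the solver on an $n\times p$ instance with sparsity $k$ takes time $T(p,n,k)$, then on every input with $n,d\ge 1$ the algorithm runs in time $O(d\,T(d-1,n,k)+d^2n)$ on a unit-cost real random access machine (arithmetic, logarithms, comparisons and memory accesses cost one unit), with an absolute implied constant. -/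

import Mathlib

open MeasureTheory ProbabilityTheory
open scoped NNReal Matrix

noncomputable section

/-! ### Vectors, sparsity, restricted eigenvalues -/

/-- Squared Euclidean norm of a real vector. -/
def sqNorm {m : ℕ} (v : Fin m → ℝ) : ℝ := ∑ t, v t ^ 2

/-- The support of a vector, as a finite set of coordinates. -/
def suppF {m : ℕ} (v : Fin m → ℝ) : Finset (Fin m) := Finset.univ.filter fun j => v j ≠ 0

/-- The `ℓ₀`-ball: vectors with at most `k` nonzero entries. -/
def IsSparse {m : ℕ} (k : ℕ) (v : Fin m → ℝ) : Prop := (suppF v).card ≤ k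

/-- The cone `{β : ‖β_{Sᶜ}‖₁ ≤ 3 ‖β_S‖₁}`. -/
def reCone {p : ℕ} (S : Finset (Fin p)) : Set (Fin p → ℝ) :=
  {β | ∑ j ∈ Sᶜ, |β j| ≤ 3 * ∑ j ∈ S, |β j|}

/-- The restricted eigenvalue constant of an `n × p` design at sparsity `k`: the largest `γ` with
`γ ‖β‖² ≤ ‖Xβ‖² / n` on the union of the cones of all `k`-subsets. The set always contains `0`
and, for `1 ≤ k ≤ p`, it is closed and bounded above; so the value is `0` exactly when no positive
constant is admissible. -/
def reConst {n p : ℕ} (X : Matrix (Fin n) (Fin p) ℝ) (k : ℕ) : ℝ :=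
  sSup {γ : ℝ | ∀ S : Finset (Fin p), S.card = k → ∀ β ∈ reCone S,
    γ * sqNorm β ≤ sqNorm (X *ᵥ β) / n}

/-! ### Solvers for sparse linear regression -/

/-- A black box for sparse linear regression: from the response `y ∈ ℝⁿ`, the `n × p` design `X`
and the sparsity `k` it returns an estimate in `ℝᵖ`. -/
abbrev SLRSolver : Type :=
  (n p : ℕ) → (Fin n → ℝ) → Matrix (Fin n) (Fin p) ℝ → ℕ → (Fin p → ℝ)

/-- For all sizes, the solver is jointly Borel measurable in the response and the (entries of the)
design. -/
def SLRSolver.IsMeasurable (slr : SLRSolver) : Prop :=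
  ∀ n p k : ℕ, Measurable fun yX : (Fin n → ℝ) × (Fin n → Fin p → ℝ) =>
    slr n p yX.1 (Matrix.of yX.2) k

/-- The law of a noise vector with i.i.d. `N(0, σ²)` entries. -/
def noiseLaw (n : ℕ) (σ : ℝ≥0) : Measure (Fin n → ℝ) :=
  Measure.pi fun _ => gaussianReal 0 (σ ^ 2)

/-- The black-box condition with constants `c, c', c''`: the output is always `k`-sparse and, for
every fixed design `X` whose restricted eigenvalue is positive, every `k`-sparse `β⋆` and every
noise level `σ`, for `y = Xβ⋆ + w` with `w ∼ N(0, σ² Iₙ)`, the prediction error is at most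
`c / γ(X)² · σ² k log p / n` with probability at least `1 - c' exp (-c'' k log p)`.
The restricted eigenvalue is capped at `1`: prediction error does not change when `X` is rescaled,
so without a normalization of `X` no solver could satisfy the uncapped bound. The cap only weakens
what is asked of the solver. -/
def SLRSolver.BlackBox (slr : SLRSolver) (c c' c'' : ℝ) : Prop :=
  (∀ (n p k : ℕ) (y : Fin n → ℝ) (X : Matrix (Fin n) (Fin p) ℝ), IsSparse k (slr n p y X k)) ∧
  ∀ n p k : ℕ, 1 ≤ n → 2 ≤ p → 1 ≤ k → k ≤ p →
    ∀ X : Matrix (Fin n) (Fin p) ℝ, 0 < reConst X k →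
    ∀ βs : Fin p → ℝ, IsSparse k βs → ∀ σ : ℝ≥0, 0 < σ →
      1 - c' * Real.exp (-c'' * k * Real.log p) ≤
        (noiseLaw n σ).real
          {w | sqNorm (X *ᵥ slr n p (X *ᵥ βs + w) X k - X *ᵥ βs) / n ≤
            c / (min (reConst X k) 1) ^ 2 * ((σ : ℝ) ^ 2 * k * Real.log p / n)}

/-! ### The single spiked covariance model -/

/-- The law of `n` i.i.d. samples from `N(0, I + θ u uᵀ)` in `ℝᵈ`. -/
def spikedLaw (n : ℕ) {d : ℕ} (θ : ℝ) (u : EuclideanSpace ℝ (Fin d)) :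
    Measure (Fin n → EuclideanSpace ℝ (Fin d)) :=
  Measure.pi fun _ => multivariateGaussian 0 (1 + θ • Matrix.vecMulVec u u)

/-- The data matrix whose rows are the samples. -/
def dataMatrix {n d : ℕ} (x : Fin n → EuclideanSpace ℝ (Fin d)) : Matrix (Fin n) (Fin d) ℝ :=
  Matrix.of fun t j => x t j

/-- At least one coordinate has enough mass without carrying almost all of it. -/
def SpikeSpread {d : ℕ} (k : ℕ) (cmin : ℝ) (u : Fin d → ℝ) : Prop :=
  ∃ i, cmin ^ 2 / k ≤ u i ^ 2 ∧ u i ^ 2 ≤ 1 - cmin ^ 2 / k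

/-- All coordinates on the support have size at least `cmin / √k`. -/
def SpikeMin {d : ℕ} (k : ℕ) (cmin : ℝ) (u : Fin d → ℝ) : Prop :=
  ∀ i, u i ≠ 0 → cmin / √(k : ℝ) ≤ |u i|

/-! ### The `Q`-support recovery algorithm -/

/-- The `n × (d-1)` matrix obtained by deleting column `i`, where `d = p + 1`. -/
def dropCol {n p : ℕ} (X : Matrix (Fin n) (Fin (p + 1)) ℝ) (i : Fin (p + 1)) :
    Matrix (Fin n) (Fin p) ℝ :=
  X.submatrix id i.succAbove

/-- The statistic `Q_i = ‖X_i‖² / n - ‖X_i - X_{-i} β̂_i‖² / n`, with `β̂_i = SLR(X_i, X_{-i}, k)`. -/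
def qStat (slr : SLRSolver) {n p : ℕ} (X : Matrix (Fin n) (Fin (p + 1)) ℝ) (k : ℕ)
    (i : Fin (p + 1)) : ℝ :=
  sqNorm (X.col i) / n -
    sqNorm (X.col i - dropCol X i *ᵥ slr n p (X.col i) (dropCol X i) k) / n

/-- The output `Ŝ = {i : Q_i > 13 k log (d / k) / n}` of `Q`-support recovery, `d = p + 1`. -/
def qSupport (slr : SLRSolver) {n p : ℕ} (X : Matrix (Fin n) (Fin (p + 1)) ℝ) (k : ℕ) :
    Finset (Fin (p + 1)) :=
  Finset.univ.filter fun i =>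
    13 * k * Real.log (((p + 1 : ℕ) : ℝ) / k) / n < qStat slr X k i

/-! ### A real random access machine with calls to the black box

Programs have natural-number registers (used for indices and loop counters) and
two-dimensional real arrays. Every arithmetic operation, memory access, comparison, assignment and
loop step costs one unit; a call of the black box on an `n × p` instance with sparsity `k` costs
`T p n k` units on top. -/

/-- Index expressions. -/
inductive IdxExp : Type
  | const (m : ℕ)
  | reg (r : ℕ)
  | add (e f : IdxExp)
  | sub (e f : IdxExp)

/-- Real expressions: `get a e f` reads the entry `(e, f)` of array `a`. -/
inductive RealExp : Type
  | ofIdx (e : IdxExp)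
  | get (a : ℕ) (e f : IdxExp)
  | add (x y : RealExp)
  | sub (x y : RealExp)
  | mul (x y : RealExp)
  | div (x y : RealExp)
  | log (x : RealExp)

/-- Programs. `loop r e c` runs `c` with register `r` set to `0, 1, …, e - 1` in turn (the bound is
evaluated once). `callSLR b y X n p k` calls the black box on the response stored in column `0` of
array `y` and the design stored in array `X`, and stores the answer in column `0` of array `b`. -/
inductive Prog : Type
  | skip
  | setIdx (r : ℕ) (e : IdxExp)
  | setReal (a : ℕ) (e f : IdxExp) (x : RealExp)
  | seq (c₁ c₂ : Prog)
  | ifIdxLt (e f : IdxExp) (c₁ c₂ : Prog)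
  | ifRealLt (x y : RealExp) (c₁ c₂ : Prog)
  | loop (r : ℕ) (e : IdxExp) (c : Prog)
  | callSLR (b y X : ℕ) (n p k : IdxExp)

/-- Machine states. -/
structure MState : Type where
  idx : ℕ → ℕ
  arr : ℕ → ℕ → ℕ → ℝ

/-- Write a register. -/
def MState.setIdx (s : MState) (r m : ℕ) : MState :=
  { s with idx := fun r' => if r' = r then m else s.idx r' }

/-- Write one array entry. -/
def MState.setReal (s : MState) (a i j : ℕ) (x : ℝ) : MState :=
  { s with arr := fun a' i' j' => if a' = a ∧ i' = i ∧ j' = j then x else s.arr a' i' j' }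

/-- Write a vector to column `0` of an array. -/
def MState.setVec (s : MState) (a : ℕ) {m : ℕ} (v : Fin m → ℝ) : MState :=
  { s with arr := fun a' i' j' =>
      if h : i' < m then (if a' = a ∧ j' = 0 then v ⟨i', h⟩ else s.arr a' i' j')
      else s.arr a' i' j' }

def IdxExp.eval (s : MState) : IdxExp → ℕ
  | const m => m
  | reg r => s.idx r
  | add e f => e.eval s + f.eval s
  | sub e f => e.eval s - f.eval s

def IdxExp.cost : IdxExp → ℕ
  | const _ => 1
  | reg _ => 1
  | add e f => e.cost + f.cost + 1
  | sub e f => e.cost + f.cost + 1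

def RealExp.eval (s : MState) : RealExp → ℝ
  | ofIdx e => (e.eval s : ℝ)
  | get a e f => s.arr a (e.eval s) (f.eval s)
  | add x y => x.eval s + y.eval s
  | sub x y => x.eval s - y.eval s
  | mul x y => x.eval s * y.eval s
  | div x y => x.eval s / y.eval s
  | log x => Real.log (x.eval s)

def RealExp.cost : RealExp → ℕ
  | ofIdx e => e.cost + 1
  | get _ e f => e.cost + f.cost + 1
  | add x y => x.cost + y.cost + 1
  | sub x y => x.cost + y.cost + 1
  | mul x y => x.cost + y.cost + 1
  | div x y => x.cost + y.cost + 1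
  | log x => x.cost + 1

/-- Run `body 0`, …, `body (m - 1)` in turn, adding up the costs, with one extra unit per round. -/
def iterCost (body : ℕ → MState → MState × ℕ) : ℕ → MState → MState × ℕ
  | 0, s => (s, 0)
  | m + 1, s =>
    ((body m (iterCost body m s).1).1,
      (iterCost body m s).2 + (body m (iterCost body m s).1).2 + 1)

open Classical in
/-- Final state and number of steps of a program, for the black box `slr` with running time `T`. -/
def Prog.run (slr : SLRSolver) (T : ℕ → ℕ → ℕ → ℕ) : Prog → MState → MState × ℕ
  | skip, s => (s, 1)
  | setIdx r e, s => (s.setIdx r (e.eval s), e.cost + 1)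
  | setReal a e f x, s =>
    (s.setReal a (e.eval s) (f.eval s) (x.eval s), e.cost + f.cost + x.cost + 1)
  | seq c₁ c₂, s =>
    ((c₂.run slr T (c₁.run slr T s).1).1,
      (c₁.run slr T s).2 + (c₂.run slr T (c₁.run slr T s).1).2)
  | ifIdxLt e f c₁ c₂, s =>
    if e.eval s < f.eval s
    then ((c₁.run slr T s).1, (c₁.run slr T s).2 + e.cost + f.cost + 1)
    else ((c₂.run slr T s).1, (c₂.run slr T s).2 + e.cost + f.cost + 1)
  | ifRealLt x y c₁ c₂, s =>
    if x.eval s < y.eval s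
    then ((c₁.run slr T s).1, (c₁.run slr T s).2 + x.cost + y.cost + 1)
    else ((c₂.run slr T s).1, (c₂.run slr T s).2 + x.cost + y.cost + 1)
  | loop r e c, s =>
    ((iterCost (fun i s' => c.run slr T (s'.setIdx r i)) (e.eval s) s).1,
      (iterCost (fun i s' => c.run slr T (s'.setIdx r i)) (e.eval s) s).2 + e.cost + 1)
  | callSLR b y X n p k, s =>
    (s.setVec b (slr (n.eval s) (p.eval s) (fun t => s.arr y t 0)
        (Matrix.of fun t j => s.arr X t j) (k.eval s)),
      T (p.eval s) (n.eval s) (k.eval s) + n.cost + p.cost + k.cost + 1)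

/-- The initial state: registers `0, 1, 2` hold `n, d, k`, array `0` holds the data matrix, and
everything else is `0`. -/
def initState {n d : ℕ} (X : Matrix (Fin n) (Fin d) ℝ) (k : ℕ) : MState where
  idx := fun r => if r = 0 then n else if r = 1 then d else if r = 2 then k else 0
  arr := fun a i j =>
    if h : a = 0 ∧ i < n ∧ j < d then X ⟨i, h.2.1⟩ ⟨j, h.2.2⟩ else 0

/-- In a final state, column `0` of array `1` holds the indicator vector of the set `S`. -/
def MState.Outputs (s : MState) {d : ℕ} (S : Finset (Fin d)) : Prop :=
  ∀ i : Fin d, s.arr 1 i 0 = if i ∈ S then 1 else 0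

end

/-! ### Gaussian tail bounds -/

/-! Regressing coordinate i on the others gives `X_i = X_{-i} b + w`, where b is proportional to u
without its i-th entry, hence k-sparse, and w is Gaussian noise independent of `X_{-i}` with
variance between 1 and 2 (`map_otherCoords_regResidual`). So each `Q_i` can be studied for a fixed
design and then averaged over the design (`spikedLaw_le_of_fixed_design`).

If `u_i = 0`, then b = 0 and the response is pure noise. The drop in residual is `2⟨w, v⟩ - ‖v‖²`
with v in the span of k columns, hence at most the squared norm of the projection of w onto that
span. A union bound over all spans of k columns keeps it below `13 k log(d/k)`; only sparsity of the
solver's output is used (`qStat_null`).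

If `u_i ≠ 0`, then `n Q_i = ‖X_{-i}b‖² + 2⟨w, X_{-i}β̂⟩ - ‖X_{-i}β̂ - X_{-i}b‖²`. The first term is
of order at least `n θ² cmin² / k`, which the hypothesis on θ makes a large multiple of `k log d`.
The inner product is controlled by projections as before, the last term by the black box, provided
that the restricted eigenvalue of `X_{-i}` is at least 1/4 (`qStat_signal`).

The eigenvalue bound avoids a covering of the cone. Maurey's empirical method writes `β/‖β‖₁` as the
mean of random signed unit vectors, so a lower bound on the quadratic form for all sums of `512k +
1` such vectors extends to every β with an error proportional to `‖β‖₁²/k`, which is harmless on the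
cone (`average_nonneg`, `quarter_le_reConst`). There are only `(2p)^(512k+1)` sums, so n of order `k
log d` suffices.

A union bound over the d coordinates finishes the probabilistic half (`support_recovery_real`). The
running time is proved for an explicit program by Hoare triples that also bound the number of steps
(`QRecovery.program_spec`). -/

theorem gaussian_exp_sq_eq (a : ℝ) (x : ℝ) :
    gaussianPDFReal 0 1 x • Real.exp (a * x ^ 2) =
      (√(2 * Real.pi))⁻¹ * Real.exp (-(1 / 2 - a) * x ^ 2) := by
  simp only [gaussianPDFReal, NNReal.coe_one, mul_one, sub_zero, smul_eq_mul]
  rw [mul_assoc, ← Real.exp_add]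
  congr 2
  ring

theorem integrable_exp_mul_sq_gaussianReal {a : ℝ} (ha : a < 1 / 2) :
    Integrable (fun x => Real.exp (a * x ^ 2)) (gaussianReal 0 1) := by
  rw [gaussianReal_of_var_ne_zero 0 one_ne_zero,
    integrable_withDensity_iff_integrable_smul' (measurable_gaussianPDF 0 1)
      (Filter.Eventually.of_forall fun x => gaussianPDF_lt_top)]
  simp only [toReal_gaussianPDF, gaussian_exp_sq_eq]
  exact (integrable_exp_neg_mul_sq (by linarith)).const_mul _

theorem integral_exp_mul_sq_gaussianReal {a : ℝ} (ha : a < 1 / 2) :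
    ∫ x, Real.exp (a * x ^ 2) ∂gaussianReal 0 1 = (√(1 - 2 * a))⁻¹ := by
  rw [integral_gaussianReal_eq_integral_smul one_ne_zero]
  simp only [gaussian_exp_sq_eq]
  rw [integral_const_mul, integral_gaussian, ← Real.sqrt_inv, ← Real.sqrt_inv,
    ← Real.sqrt_mul (by positivity)]
  congr 1
  have : (1 : ℝ) - 2 * a ≠ 0 := by linarith
  have : (1 : ℝ) / 2 - a ≠ 0 := by linarith
  have := Real.pi_ne_zero
  field_simp

section
variable {ι : Type*} [Fintype ι]

theorem integrable_exp_mul_sum_sq {a : ℝ} (ha : a < 1 / 2) :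
    Integrable (fun x : ι → ℝ => Real.exp (a * ∑ i, x i ^ 2))
      (Measure.pi fun _ => gaussianReal 0 1) := by
  simp only [Finset.mul_sum, Real.exp_sum]
  exact Integrable.fintype_prod fun _ => integrable_exp_mul_sq_gaussianReal ha

theorem mgf_sum_sq_gaussian {a : ℝ} (ha : a < 1 / 2) :
    mgf (fun x : ι → ℝ => ∑ i, x i ^ 2) (Measure.pi fun _ => gaussianReal 0 1) a =
      (√(1 - 2 * a))⁻¹ ^ Fintype.card ι := by
  simp only [mgf, Finset.mul_sum, Real.exp_sum]
  rw [integral_fintype_prod_eq_pow (fun x : ℝ => Real.exp (a * x ^ 2)),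
    integral_exp_mul_sq_gaussianReal ha]

/-- Chernoff bound with parameter 3/8, chosen because `√(1 - 2·3/8) = 1/2` makes the moment
generating function exactly 2 per coordinate. -/
theorem gaussian_sum_sq_upper_tail (t : ℝ) :
    (Measure.pi fun _ : ι => gaussianReal 0 1).real {x | t ≤ ∑ i, x i ^ 2} ≤
      2 ^ Fintype.card ι * Real.exp (-(3 / 8) * t) := by
  have h := measure_ge_le_exp_mul_mgf (μ := Measure.pi fun _ : ι => gaussianReal 0 1)
    (X := fun x : ι → ℝ => ∑ i, x i ^ 2) t (t := 3 / 8) (by norm_num)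
    (integrable_exp_mul_sum_sq (by norm_num))
  rw [mgf_sum_sq_gaussian (by norm_num)] at h
  have h4 : (√(1 - 2 * (3 / 8) : ℝ))⁻¹ = 2 := by
    rw [show (1 - 2 * (3 / 8) : ℝ) = (1 / 2) ^ 2 by norm_num, Real.sqrt_sq (by norm_num)]
    norm_num
  rw [h4] at h
  linarith

/-- The left side is the factor per coordinate in the Chernoff bound with parameter -1 for the lower
tail at half the mean. The claim amounts to `e^12 ≤ 3^11`. -/
theorem exp_half_mul_inv_sqrt_three_le : Real.exp (1 / 2) * (√3)⁻¹ ≤ Real.exp (-(1 / 22)) := by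
  have h1 : Real.exp (12 / 11) ≤ 3 := by
    have h : Real.exp (12 / 11) ^ 11 ≤ 3 ^ 11 := by
      rw [← Real.exp_nat_mul, show ((11 : ℕ) : ℝ) * (12 / 11) = (12 : ℕ) * 1 by norm_num,
        Real.exp_nat_mul]
      calc Real.exp 1 ^ 12 ≤ 2.7182818286 ^ 12 := by
            gcongr; exact Real.exp_one_lt_d9.le
        _ ≤ 3 ^ 11 := by norm_num
    exact le_of_pow_le_pow_left₀ (by norm_num) (by norm_num) h
  have h2 : Real.exp (6 / 11) ≤ √3 := by
    apply Real.le_sqrt_of_sq_le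
    rw [← Real.exp_nat_mul]
    norm_num
    exact h1
  have h3 : (0 : ℝ) < √3 := by positivity
  rw [← div_eq_mul_inv, div_le_iff₀ h3]
  calc Real.exp (1 / 2) = Real.exp (-(1 / 22)) * Real.exp (6 / 11) := by
        rw [← Real.exp_add]; norm_num
    _ ≤ _ := by gcongr

theorem gaussian_sum_sq_lower_tail :
    (Measure.pi fun _ : ι => gaussianReal 0 1).real {x | ∑ i, x i ^ 2 ≤ Fintype.card ι / 2} ≤
      Real.exp (-(Fintype.card ι / 22)) := by
  have h := measure_le_le_exp_mul_mgf (μ := Measure.pi fun _ : ι => gaussianReal 0 1)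
    (X := fun x : ι → ℝ => ∑ i, x i ^ 2) (Fintype.card ι / 2 : ℝ) (t := -1) (by norm_num)
    (integrable_exp_mul_sum_sq (by norm_num))
  rw [mgf_sum_sq_gaussian (by norm_num)] at h
  refine h.trans ?_
  calc Real.exp (- -1 * (Fintype.card ι / 2)) * (√(1 - 2 * -1))⁻¹ ^ Fintype.card ι
      = (Real.exp (1 / 2) * (√3)⁻¹) ^ Fintype.card ι := by
        rw [mul_pow, ← Real.exp_nat_mul]; norm_num; ring
    _ ≤ Real.exp (-(1 / 22)) ^ Fintype.card ι := by
        gcongr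
        exact exp_half_mul_inv_sqrt_three_le
    _ = _ := by rw [← Real.exp_nat_mul]; congr 1; ring

end

/-! ### Noise vectors as scaled standard Gaussians. -/

instance (n : ℕ) (σ : ℝ≥0) : IsProbabilityMeasure (noiseLaw n σ) := by
  unfold noiseLaw; infer_instance

theorem noiseLaw_eq_map (n : ℕ) (σ : ℝ≥0) :
    noiseLaw n σ = (noiseLaw n 1).map fun w t => (σ : ℝ) * w t := by
  unfold noiseLaw
  rw [show (fun (w : Fin n → ℝ) t => (σ : ℝ) * w t) =
    fun w t => (fun (_ : Fin n) x => (σ : ℝ) * x) t (w t) from rfl]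
  rw [Measure.pi_map_pi fun _ => by fun_prop]
  congr 1
  ext1 t
  rw [gaussianReal_map_const_mul]
  congr 1
  · simp
  · ext; simp

theorem noiseLaw_real_eq (n : ℕ) (σ : ℝ≥0) {s : Set (Fin n → ℝ)} (hs : MeasurableSet s) :
    (noiseLaw n σ).real s = (Measure.pi fun _ : Fin n => gaussianReal 0 1).real
      {w | (fun t => (σ : ℝ) * w t) ∈ s} := by
  rw [noiseLaw_eq_map, map_measureReal_apply (by fun_prop) hs]
  simp [noiseLaw]
  rfl

theorem sqNorm_smul {m : ℕ} (a : ℝ) (v : Fin m → ℝ) :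
    sqNorm (a • v) = a ^ 2 * sqNorm v := by
  simp [sqNorm, Finset.mul_sum, mul_pow]

@[fun_prop]
theorem measurable_sqNorm {m : ℕ} : Measurable (sqNorm (m := m)) := by
  unfold sqNorm; fun_prop

theorem sqNorm_eq_norm_sq {m : ℕ} (v : Fin m → ℝ) : sqNorm v = ‖WithLp.toLp 2 v‖ ^ 2 := by
  simp [sqNorm, EuclideanSpace.real_norm_sq_eq]

theorem noiseLaw_sqNorm_upper_tail (n : ℕ) {σ : ℝ≥0} (hσ : 0 < σ) :
    (noiseLaw n σ).real {w | 4 * n * (σ : ℝ) ^ 2 ≤ sqNorm w} ≤ Real.exp (-(n / 22)) := by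
  rw [noiseLaw_real_eq _ _ (measurableSet_le (by fun_prop) (by fun_prop))]
  have hσ' : (0 : ℝ) < (σ : ℝ) ^ 2 := by positivity
  have : {w : Fin n → ℝ | (fun t => (σ : ℝ) * w t) ∈
      {w : Fin n → ℝ | 4 * n * (σ : ℝ) ^ 2 ≤ sqNorm w}} = {w | 4 * (n : ℝ) ≤ ∑ t, w t ^ 2} := by
    ext w
    simp only [Set.mem_ofPred_eq]
    rw [show (fun t => (σ : ℝ) * w t) = (σ : ℝ) • w from rfl, sqNorm_smul, mul_comm,
      mul_le_mul_iff_right₀ hσ']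
    rfl
  rw [this]
  refine (gaussian_sum_sq_upper_tail _).trans ?_
  have h2 : (2 : ℝ) ≤ Real.exp 1 := by have := Real.exp_one_gt_d9; linarith
  calc (2 : ℝ) ^ Fintype.card (Fin n) * Real.exp (-(3 / 8) * (4 * n))
      ≤ Real.exp 1 ^ Fintype.card (Fin n) * Real.exp (-(3 / 8) * (4 * n)) := by gcongr
    _ = Real.exp (-(n / 2)) := by
        rw [← Real.exp_nat_mul, ← Real.exp_add, Fintype.card_fin]; congr 1; ring
    -- The rate n/2 is given up so that upper and lower tail share the rate n/22.
    _ ≤ _ := by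
        gcongr; norm_num

theorem noiseLaw_sqNorm_lower_tail (n : ℕ) {σ : ℝ≥0} (hσ : 0 < σ) :
    (noiseLaw n σ).real {w | sqNorm w ≤ n / 2 * (σ : ℝ) ^ 2} ≤ Real.exp (-(n / 22)) := by
  rw [noiseLaw_real_eq _ _ (measurableSet_le (by fun_prop) (by fun_prop))]
  have hσ' : (0 : ℝ) < (σ : ℝ) ^ 2 := by positivity
  have : {w : Fin n → ℝ | (fun t => (σ : ℝ) * w t) ∈
      {w : Fin n → ℝ | sqNorm w ≤ n / 2 * (σ : ℝ) ^ 2}} =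
      {w | ∑ t, w t ^ 2 ≤ (Fintype.card (Fin n) : ℝ) / 2} := by
    ext w
    simp only [Set.mem_ofPred_eq]
    rw [show (fun t => (σ : ℝ) * w t) = (σ : ℝ) • w from rfl, sqNorm_smul,
      mul_comm (n / 2 : ℝ), mul_le_mul_iff_right₀ hσ', Fintype.card_fin]
    rfl
  rw [this]
  simpa using gaussian_sum_sq_lower_tail (ι := Fin n)

/-! ### Projections of Gaussian vectors -/

/-- Characteristic functions agree: for t in V, pairing t with the projection of w is pairing t with
w, and t has the same norm in V and in E. -/
theorem stdGaussian_map_orthogonalProjection {E : Type*} [NormedAddCommGroup E]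
    [InnerProductSpace ℝ E] [FiniteDimensional ℝ E] [MeasurableSpace E] [BorelSpace E]
    (V : Submodule ℝ E) :
    (stdGaussian E).map V.orthogonalProjectionOnto = stdGaussian V := by
  apply Measure.ext_of_charFun
  ext t
  rw [charFun_stdGaussian, charFun_apply, integral_map (by fun_prop) (by fun_prop)]
  have := charFun_stdGaussian (t : E)
  rw [charFun_apply] at this
  simp only [Submodule.inner_orthogonalProjectionOnto_eq_of_mem_right, this, Submodule.coe_norm]

/-- In an orthonormal basis of V the squared norm is a sum of `finrank V` squared standard normals,
so the ambient dimension n does not enter. -/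
theorem gaussian_projection_upper_tail {n m : ℕ} (V : Submodule ℝ (EuclideanSpace ℝ (Fin n)))
    (hV : Module.finrank ℝ V ≤ m) (t : ℝ) :
    (Measure.pi fun _ : Fin n => gaussianReal 0 1).real
      {w | t ≤ ‖V.orthogonalProjectionOnto (WithLp.toLp 2 w)‖ ^ 2} ≤
        2 ^ m * Real.exp (-(3 / 8) * t) := by
  have hm : MeasurableSet {v : V | t ≤ ‖v‖ ^ 2} := measurableSet_le (by fun_prop) (by fun_prop)
  have h1 : (Measure.pi fun _ : Fin n => gaussianReal 0 1).real
      {w | t ≤ ‖V.orthogonalProjectionOnto (WithLp.toLp 2 w)‖ ^ 2} =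
      (stdGaussian V).real {v | t ≤ ‖v‖ ^ 2} := by
    rw [← stdGaussian_map_orthogonalProjection, map_measureReal_apply (by fun_prop) hm,
      ← map_pi_eq_stdGaussian, map_measureReal_apply (by fun_prop)
        (hm.preimage (by fun_prop))]
    rfl
  rw [h1, stdGaussian, map_measureReal_apply (by fun_prop) hm]
  have h2 : (fun x : Fin (Module.finrank ℝ V) → ℝ => ∑ i, x i • stdOrthonormalBasis ℝ V i) ⁻¹'
      {v | t ≤ ‖v‖ ^ 2} = {x | t ≤ ∑ i, x i ^ 2} := by
    ext x
    simp only [Set.mem_preimage, Set.mem_ofPred_eq]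
    rw [← real_inner_self_eq_norm_sq, (stdOrthonormalBasis ℝ V).orthonormal.inner_sum]
    simp [pow_two]
  rw [h2]
  refine (gaussian_sum_sq_upper_tail t).trans ?_
  gcongr
  · norm_num
  · simpa using hV

/-- The excess `2⟨w, v⟩ - ‖v‖²` is at most the squared norm of the projection of `w`. -/
theorem two_inner_sub_norm_sq_le {E : Type*} [NormedAddCommGroup E]
    [InnerProductSpace ℝ E] [FiniteDimensional ℝ E] (V : Submodule ℝ E) (w : E) {v : E}
    (hv : v ∈ V) : 2 * inner ℝ w v - ‖v‖ ^ 2 ≤ ‖V.orthogonalProjectionOnto w‖ ^ 2 := by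
  have h := Submodule.inner_orthogonalProjectionOnto_eq_of_mem_right ⟨v, hv⟩ w
  have h1 := real_inner_le_norm (V.orthogonalProjectionOnto w) ⟨v, hv⟩
  simp only [Submodule.coe_norm] at h1 ⊢
  simp only [Submodule.coe_inner] at h h1
  nlinarith [sq_nonneg (‖(V.orthogonalProjectionOnto w : E)‖ - ‖v‖)]

theorem abs_inner_le_projection {E : Type*} [NormedAddCommGroup E]
    [InnerProductSpace ℝ E] [FiniteDimensional ℝ E] (V : Submodule ℝ E) (w : E) {v : E}
    (hv : v ∈ V) : |inner ℝ w v| ≤ ‖V.orthogonalProjectionOnto w‖ * ‖v‖ := by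
  have h := Submodule.inner_orthogonalProjectionOnto_eq_of_mem_right ⟨v, hv⟩ w
  rw [← h]
  exact abs_real_inner_le_norm _ _

theorem noiseLaw_projection_upper_tail {n m : ℕ} {σ : ℝ≥0} (hσ : 0 < σ)
    (V : Submodule ℝ (EuclideanSpace ℝ (Fin n))) (hV : Module.finrank ℝ V ≤ m) (t : ℝ) :
    (noiseLaw n σ).real {w | (σ : ℝ) ^ 2 * t ≤ ‖V.orthogonalProjectionOnto (WithLp.toLp 2 w)‖ ^ 2} ≤
      2 ^ m * Real.exp (-(3 / 8) * t) := by
  rw [noiseLaw_real_eq _ _ (measurableSet_le (by fun_prop) (by fun_prop))]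
  have hσ' : (0 : ℝ) < (σ : ℝ) ^ 2 := by positivity
  convert gaussian_projection_upper_tail V hV t using 2
  ext w
  simp only [Set.mem_ofPred_eq]
  rw [show WithLp.toLp 2 (fun t => (σ : ℝ) * w t) = (σ : ℝ) • WithLp.toLp 2 w from rfl, map_smul,
    norm_smul, mul_pow, Real.norm_eq_abs, sq_abs, mul_le_mul_iff_right₀ hσ']

/-! ### The statistic for a fixed design -/

/-- The span of the columns of `X` with index in `A`. -/
noncomputable def colSpan {n p : ℕ} (X : Matrix (Fin n) (Fin p) ℝ) (A : Finset (Fin p)) :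
    Submodule ℝ (EuclideanSpace ℝ (Fin n)) :=
  Submodule.span ℝ (A.image fun j => WithLp.toLp 2 (X.col j) : Finset _)

theorem finrank_colSpan_le {n p : ℕ} (X : Matrix (Fin n) (Fin p) ℝ) (A : Finset (Fin p)) :
    Module.finrank ℝ (colSpan X A) ≤ A.card :=
  (finrank_span_finset_le_card _).trans Finset.card_image_le

theorem mulVec_mem_colSpan {n p : ℕ} (X : Matrix (Fin n) (Fin p) ℝ) {A : Finset (Fin p)}
    {b : Fin p → ℝ} (hb : suppF b ⊆ A) : WithLp.toLp 2 (X *ᵥ b) ∈ colSpan X A := by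
  have h : WithLp.toLp 2 (X *ᵥ b) = ∑ j ∈ A, b j • WithLp.toLp 2 (X.col j) := by
    rw [Finset.sum_subset (Finset.subset_univ A)]
    · ext t
      simp [Matrix.mulVec, dotProduct, Matrix.col, mul_comm]
    · intro j _ hj
      have : b j = 0 := by
        by_contra h
        exact hj (hb (by simp [suppF, h]))
      simp [this]
  rw [h]
  refine Submodule.sum_mem _ fun j hj => Submodule.smul_mem _ _ (Submodule.subset_span ?_)
  simpa using ⟨j, hj, rfl⟩

theorem IsSparse.exists_superset {p k : ℕ} {b : Fin p → ℝ} (hb : IsSparse k b) (hk : k ≤ p) :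
    ∃ A ∈ Finset.powersetCard k (Finset.univ : Finset (Fin p)), suppF b ⊆ A := by
  obtain ⟨A, h1, h2⟩ := Finset.exists_superset_card_eq hb (by simpa using hk)
  exact ⟨A, by simp [h2], h1⟩

/-- This is `C(p,k) ≤ (ep/k)^k`, the extra `e^k` being absorbed by `L ≥ 1`. The cruder `p^k` would
not do in the null case, where the threshold involves `log(d/k)` and not `log d`. -/
theorem choose_le_exp {p k : ℕ} (hk : 1 ≤ k) {L : ℝ} (hL : 1 ≤ L)
    (hp : (p : ℝ) / k ≤ Real.exp L) : (p.choose k : ℝ) ≤ Real.exp (2 * k * L) := by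
  have hk0 : (0 : ℝ) < k := by exact_mod_cast hk
  calc (p.choose k : ℝ) ≤ (p : ℝ) ^ k / k.factorial := Nat.choose_le_pow_div k p
    _ = ((p : ℝ) / k) ^ k * ((k : ℝ) ^ k / k.factorial) := by
        rw [div_pow]; field_simp
    _ ≤ Real.exp L ^ k * Real.exp k := by
        gcongr
        exact Real.pow_div_factorial_le_exp _ hk0.le k
    _ = Real.exp (k * L + k * 1) := by rw [← Real.exp_nat_mul, ← Real.exp_add, mul_one]
    _ ≤ _ := by
        gcongr
        nlinarith

theorem two_pow_le_exp (k : ℕ) : (2 : ℝ) ^ k ≤ Real.exp (0.7 * k) := by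
  have h : (2 : ℝ) ≤ Real.exp 0.7 := by
    rw [← Real.log_le_iff_le_exp (by norm_num)]
    have := Real.log_two_lt_d9
    linarith
  calc (2 : ℝ) ^ k ≤ Real.exp 0.7 ^ k := by gcongr
    _ = _ := by rw [← Real.exp_nat_mul, mul_comm]

/-- The support of the estimate depends on the noise, so the projection must be controlled for all
k-subsets at once. -/
theorem noiseLaw_exists_projection_tail {n p k : ℕ} {σ : ℝ≥0} (hσ : 0 < σ)
    (X : Matrix (Fin n) (Fin p) ℝ) (t : ℝ) :
    (noiseLaw n σ).real {w | ∃ A ∈ Finset.powersetCard k (Finset.univ : Finset (Fin p)),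
      (σ : ℝ) ^ 2 * t ≤ ‖(colSpan X A).orthogonalProjectionOnto (WithLp.toLp 2 w)‖ ^ 2} ≤
      p.choose k * Real.exp (0.7 * k - 3 / 8 * t) := by
  have h : {w | ∃ A ∈ Finset.powersetCard k (Finset.univ : Finset (Fin p)),
      (σ : ℝ) ^ 2 * t ≤ ‖(colSpan X A).orthogonalProjectionOnto (WithLp.toLp 2 w)‖ ^ 2} =
      ⋃ A ∈ Finset.powersetCard k (Finset.univ : Finset (Fin p)), {w | (σ : ℝ) ^ 2 * t ≤
        ‖(colSpan X A).orthogonalProjectionOnto (WithLp.toLp 2 w)‖ ^ 2} := by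
    ext w; simp
  rw [h]
  refine (measureReal_biUnion_finset_le _ _).trans ?_
  have h2 : ∀ A ∈ Finset.powersetCard k (Finset.univ : Finset (Fin p)),
      (noiseLaw n σ).real {w | (σ : ℝ) ^ 2 * t ≤
        ‖(colSpan X A).orthogonalProjectionOnto (WithLp.toLp 2 w)‖ ^ 2} ≤
      Real.exp (0.7 * k - 3 / 8 * t) := by
    intro A hA
    rw [Finset.mem_powersetCard] at hA
    refine (noiseLaw_projection_upper_tail hσ _
      ((finrank_colSpan_le X A).trans hA.2.le) t).trans ?_
    rw [sub_eq_add_neg, Real.exp_add, neg_mul]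
    gcongr
    exact two_pow_le_exp k
  refine (Finset.sum_le_card_nsmul _ _ _ h2).trans ?_
  simp

theorem sqNorm_sub_sqNorm_sub {n : ℕ} (y v : Fin n → ℝ) :
    sqNorm y - sqNorm (y - v) =
      2 * inner ℝ (WithLp.toLp 2 y) (WithLp.toLp 2 v) - ‖WithLp.toLp 2 v‖ ^ 2 := by
  rw [sqNorm_eq_norm_sq, sqNorm_eq_norm_sq, WithLp.toLp_sub, norm_sub_sq_real]
  ring

/-- For pure noise the statistic exceeds the threshold with exponentially small probability. -/
theorem qStat_null_fixed_design {slr : SLRSolver}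
    (hs : ∀ (n p k : ℕ) (y : Fin n → ℝ) (X : Matrix (Fin n) (Fin p) ℝ),
      IsSparse k (slr n p y X k)) {n p k : ℕ} (hn : 1 ≤ n) (hk : 1 ≤ k) (hkp : k ≤ p)
    {L : ℝ} (hL : 1 ≤ L) (hp : (p : ℝ) / k ≤ Real.exp L)
    (X : Matrix (Fin n) (Fin p) ℝ) :
    (noiseLaw n 1).real {w | 13 * k * L / n <
      sqNorm w / n - sqNorm (w - X *ᵥ slr n p w X k) / n} ≤ Real.exp (-(2 * k * L)) := by
  have hk1 : (1 : ℝ) ≤ k := by exact_mod_cast hk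
  have hn0 : (0 : ℝ) < n := by exact_mod_cast hn
  have hsub : {w | 13 * k * L / n < sqNorm w / n - sqNorm (w - X *ᵥ slr n p w X k) / n} ⊆
      {w | ∃ A ∈ Finset.powersetCard k (Finset.univ : Finset (Fin p)),
        ((1 : ℝ≥0) : ℝ) ^ 2 * (13 * k * L) ≤
          ‖(colSpan X A).orthogonalProjectionOnto (WithLp.toLp 2 w)‖ ^ 2} := by
    intro w hw
    rw [Set.mem_ofPred_eq, ← sub_div, div_lt_div_iff_of_pos_right hn0,
      sqNorm_sub_sqNorm_sub] at hw
    obtain ⟨A, hA, hA'⟩ := (hs n p k w X).exists_superset hkp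
    refine ⟨A, hA, ?_⟩
    have := two_inner_sub_norm_sq_le (colSpan X A) (WithLp.toLp 2 w) (mulVec_mem_colSpan X hA')
    simp only [NNReal.coe_one, one_pow, one_mul]
    linarith
  refine (measureReal_mono hsub).trans ((noiseLaw_exists_projection_tail one_pos X _).trans ?_)
  calc (p.choose k : ℝ) * Real.exp (0.7 * k - 3 / 8 * (13 * k * L))
      ≤ Real.exp (2 * k * L) * Real.exp (0.7 * k - 3 / 8 * (13 * k * L)) := by
        gcongr
        exact choose_le_exp hk hL hp
    _ = Real.exp (2 * k * L + 0.7 * k - 3 / 8 * (13 * k * L)) := by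
        rw [← Real.exp_add]; congr 1; ring
    -- Here the threshold constant 13 is used: 13·3/8 = 4.875 pays for the 2 of the union bound, the
    -- 2 kept in the conclusion, and the 0.7 from `2^k`.
    _ ≤ _ := by
        gcongr
        nlinarith

/-- Here s is the norm of the signal, r that of the projected noise, and D² the prediction error.
Since `2rs ≤ s²/2 + 2r²` and `2rD ≤ r² + D²`, the right side is at least `s²/2 - 3r² - 2D² ≥ (110 +
64c - 96 - 64c) κ = 14κ`; this dictates 220 and 128. -/
theorem signal_dominates {s r D κ c : ℝ} (hs : (220 + 128 * c) * κ ≤ s ^ 2)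
    (hr : r ^ 2 ≤ 32 * κ) (hD : D ^ 2 ≤ 32 * c * κ) (hκ : 0 < κ) :
    13 * κ < s ^ 2 - 2 * (r * (s + D)) - D ^ 2 := by
  nlinarith [sq_nonneg (s / 2 - 2 * r), sq_nonneg (r - D), sq_nonneg (s - 2 * r)]

/-- For a design with large restricted eigenvalue and a strong signal the statistic passes the
threshold with overwhelming probability. -/
theorem qStat_signal_fixed_design {slr : SLRSolver} {c c' c'' : ℝ} (hc : 0 < c)
    (hmeas : slr.IsMeasurable) (hs : slr.BlackBox c c' c'')
    {n p k : ℕ} (hn : 1 ≤ n) (hp2 : 2 ≤ p) (hk : 1 ≤ k) (hkp : k ≤ p) {ℓ thr : ℝ}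
    (hℓ : 1 ≤ ℓ) (hpℓ : Real.log p ≤ ℓ) (hpe : (p : ℝ) ≤ Real.exp ℓ) (hthr : thr ≤ ℓ)
    (X : Matrix (Fin n) (Fin p) ℝ) (hX : 1 / 4 ≤ reConst X k) {βs : Fin p → ℝ}
    (hβ : IsSparse k βs) (hsig : (220 + 128 * c) * (k * ℓ) ≤ sqNorm (X *ᵥ βs))
    {σ : ℝ≥0} (hσ : 0 < σ) (hσ2 : (σ : ℝ) ^ 2 ≤ 2) :
    (noiseLaw n σ).real {w | sqNorm (X *ᵥ βs + w) / n -
      sqNorm (X *ᵥ βs + w - X *ᵥ slr n p (X *ᵥ βs + w) X k) / n ≤ 13 * k * thr / n} ≤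
      c' * Real.exp (-c'' * k * Real.log p) + Real.exp (-(4 * k * ℓ)) := by
  have hk1 : (1 : ℝ) ≤ k := by exact_mod_cast hk
  have hn0 : (0 : ℝ) < n := by exact_mod_cast hn
  set good := {w | sqNorm (X *ᵥ slr n p (X *ᵥ βs + w) X k - X *ᵥ βs) / n ≤
            c / (min (reConst X k) 1) ^ 2 * ((σ : ℝ) ^ 2 * k * Real.log p / n)} with hgood
  set big := {w | ∃ A ∈ Finset.powersetCard k (Finset.univ : Finset (Fin p)), (σ : ℝ) ^ 2 *
    (16 * (k * ℓ)) ≤ ‖(colSpan X A).orthogonalProjectionOnto (WithLp.toLp 2 w)‖ ^ 2} with hbig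
  have hgm : MeasurableSet good := by
    have h1 : Measurable fun w : Fin n → ℝ => slr n p (X *ᵥ βs + w) X k :=
      (hmeas n p k).comp (f := fun w : Fin n → ℝ => (X *ᵥ βs + w, fun i j => X i j))
        (by fun_prop)
    have h2 : Measurable fun w : Fin n → ℝ => X *ᵥ slr n p (X *ᵥ βs + w) X k := by
      refine measurable_pi_lambda _ fun t => ?_
      simp only [Matrix.mulVec, dotProduct]
      exact Finset.measurable_sum _ fun j _ => ((measurable_pi_apply j).comp h1).const_mul _
    exact measurableSet_le ((measurable_sqNorm.comp (h2.sub_const _)).div_const _)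
      measurable_const
  have hsub : {w | sqNorm (X *ᵥ βs + w) / n -
      sqNorm (X *ᵥ βs + w - X *ᵥ slr n p (X *ᵥ βs + w) X k) / n ≤ 13 * k * thr / n} ⊆
      goodᶜ ∪ big := by
    intro w hw
    by_contra hcon
    rw [Set.mem_union, not_or, Set.mem_compl_iff, not_not] at hcon
    obtain ⟨h1, h2⟩ := hcon
    rw [hgood, Set.mem_ofPred_eq] at h1
    rw [Set.mem_ofPred_eq, ← sub_div, div_le_div_iff_of_pos_right hn0] at hw
    set b := slr n p (X *ᵥ βs + w) X k
    obtain ⟨A, hA, hA'⟩ := (hs.1 n p k (X *ᵥ βs + w) X).exists_superset hkp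
    have h3 : ‖(colSpan X A).orthogonalProjectionOnto (WithLp.toLp 2 w)‖ ^ 2 ≤ 32 * (k * ℓ) := by
      by_contra h
      refine h2 ⟨A, hA, ?_⟩
      have : (σ : ℝ) ^ 2 * (16 * (k * ℓ)) ≤ 2 * (16 * (k * ℓ)) := by gcongr
      linarith
    -- The factor 32 is 16 from the restricted eigenvalue 1/4 times 2 from the noise variance.
    have h4 : sqNorm (X *ᵥ b - X *ᵥ βs) ≤ 32 * c * (k * ℓ) := by
      have hmin : (1 / 4 : ℝ) ≤ min (reConst X k) 1 := le_min hX (by norm_num)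
      have h5 : c / (min (reConst X k) 1) ^ 2 ≤ 16 * c := by
        have hsq : (1 / 4 : ℝ) ^ 2 ≤ (min (reConst X k) 1) ^ 2 := by gcongr
        rw [div_le_iff₀ (by positivity)]
        nlinarith
      have h6 : sqNorm (X *ᵥ b - X *ᵥ βs) / n ≤ 16 * c * (2 * k * ℓ / n) := by
        refine h1.trans ?_
        gcongr
      rw [div_le_iff₀ hn0] at h6
      refine h6.trans (le_of_eq ?_)
      field_simp
      ring
    rw [sqNorm_eq_norm_sq] at hsig h4
    have h7 := abs_inner_le_projection (colSpan X A) (WithLp.toLp 2 w) (mulVec_mem_colSpan X hA')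
    have h8 := signal_dominates hsig h3 h4 (by positivity)
    have h9 : ‖WithLp.toLp 2 (X *ᵥ b)‖ ≤
        ‖WithLp.toLp 2 (X *ᵥ βs)‖ + ‖WithLp.toLp 2 (X *ᵥ b - X *ᵥ βs)‖ := by
      have := norm_add_le (WithLp.toLp 2 (X *ᵥ βs)) (WithLp.toLp 2 (X *ᵥ b - X *ᵥ βs))
      rwa [← WithLp.toLp_add, add_sub_cancel] at this
    -- The noise energy and its correlation with the true signal cancel; the noise meets only the
    -- fitted vector, which lies in a span of k columns.
    have h10 : sqNorm (X *ᵥ βs + w) - sqNorm (X *ᵥ βs + w - X *ᵥ b) =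
        ‖WithLp.toLp 2 (X *ᵥ βs)‖ ^ 2 + 2 * inner ℝ (WithLp.toLp 2 w) (WithLp.toLp 2 (X *ᵥ b))
          - ‖WithLp.toLp 2 (X *ᵥ b - X *ᵥ βs)‖ ^ 2 := by
      rw [sqNorm_sub_sqNorm_sub, WithLp.toLp_sub, norm_sub_sq_real, WithLp.toLp_add,
        inner_add_left, real_inner_comm (WithLp.toLp 2 (X *ᵥ b)) (WithLp.toLp 2 (X *ᵥ βs))]
      ring
    have h11 := mul_le_mul_of_nonneg_left h9
      (norm_nonneg ((colSpan X A).orthogonalProjectionOnto (WithLp.toLp 2 w)))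
    have h12 := neg_abs_le (inner ℝ (WithLp.toLp 2 w) (WithLp.toLp 2 (X *ᵥ b)))
    have h13 : 13 * k * thr ≤ 13 * (k * ℓ) := by nlinarith
    linarith
  refine (measureReal_mono hsub).trans ((measureReal_union_le _ _).trans (add_le_add ?_ ?_))
  · rw [probReal_compl_eq_one_sub hgm]
    have := hs.2 n p k hn hp2 hk hkp X (by linarith) βs hβ σ hσ
    linarith
  · refine (noiseLaw_exists_projection_tail hσ X _).trans ?_
    calc (p.choose k : ℝ) * Real.exp (0.7 * k - 3 / 8 * (16 * (k * ℓ)))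
        ≤ Real.exp ℓ ^ k * Real.exp (0.7 * k - 3 / 8 * (16 * (k * ℓ))) := by
          gcongr
          calc (p.choose k : ℝ) ≤ (p : ℝ) ^ k := by exact_mod_cast Nat.choose_le_pow p k
            _ ≤ _ := by gcongr
      _ = Real.exp (k * ℓ + 0.7 * k - 3 / 8 * (16 * (k * ℓ))) := by
          rw [← Real.exp_nat_mul, ← Real.exp_add]; congr 1; ring
      _ ≤ _ := by
          gcongr
          nlinarith

/-! ### Restricted eigenvalues from finitely many inequalities -/

/-- If a quadratic form is nonnegative on all sums of `N` of the vectors `a j`, then so is its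
average over independent random choices of the summands. -/
theorem LinearMap.BilinForm.average_nonneg {M ι : Type*} [AddCommGroup M] [Module ℝ M] [Fintype ι]
    (B : LinearMap.BilinForm ℝ M) (hB : ∀ x y, B x y = B y x) (a : ι → M) {w : ι → ℝ}
    (hw : ∀ j, 0 ≤ w j) (hw1 : ∑ j, w j = 1) (N : ℕ) :
    ∀ v : M, (∀ J : Fin N → ι, 0 ≤ B (v + ∑ l, a (J l)) (v + ∑ l, a (J l))) →
      0 ≤ B v v + 2 * N * B v (∑ j, w j • a j) +
        N * (N - 1) * B (∑ j, w j • a j) (∑ j, w j • a j) + N * ∑ j, w j * B (a j) (a j) := by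
  set b := ∑ j, w j • a j with hb
  induction N with
  | zero => intro v h; simpa using h Fin.elim0
  | succ N ih =>
    intro v h
    -- Fix the first draw to be j, apply the induction hypothesis from `v + a j`, and then average
    -- over j with weights w.
    have h1 : ∀ j, 0 ≤ w j * (B (v + a j) (v + a j) + 2 * N * B (v + a j) b +
        N * (N - 1) * B b b + N * ∑ j, w j * B (a j) (a j)) := by
      intro j
      refine mul_nonneg (hw j) (ih _ fun J => ?_)
      have := h (Fin.cons j J)
      simpa [Fin.sum_univ_succ, add_assoc] using this
    have h2 := Finset.sum_nonneg fun j (_ : j ∈ Finset.univ) => h1 j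
    have e1' : ∀ v, ∑ j, w j * B v (a j) = B v b := fun v => by simp [hb, map_sum]
    have e1 := e1' v
    have e2 : ∑ j, w j * B (a j) b = B b b := by
      rw [← e1' b]
      exact Finset.sum_congr rfl fun j _ => by rw [hB]
    have e3 : ∀ j, w j * (B (v + a j) (v + a j) + 2 * N * B (v + a j) b +
        N * (N - 1) * B b b + N * ∑ j, w j * B (a j) (a j)) =
        w j * (B v v + 2 * N * B v b + N * (N - 1) * B b b + N * ∑ j, w j * B (a j) (a j)) +
        2 * (w j * B v (a j)) + w j * B (a j) (a j) + 2 * N * (w j * B (a j) b) := by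
      intro j
      simp only [map_add, LinearMap.add_apply]
      rw [hB (a j) v]
      ring
    simp only [e3, Finset.sum_add_distrib, ← Finset.mul_sum, ← Finset.sum_mul, e1, e2, hw1] at h2
    push_cast
    linarith

/-- Sums of signed unit vectors. -/
noncomputable def signedSum {p N : ℕ} (J : Fin N → Fin p × Bool) : Fin p → ℝ :=
  ∑ l, (if (J l).2 then (1 : ℝ) else -1) • Pi.single (J l).1 (1 : ℝ)

/-- The form `⟨Xu, Xv⟩ / n - ⟨u, v⟩ / 2`. -/
noncomputable def excessForm {n p : ℕ} (X : Matrix (Fin n) (Fin p) ℝ) :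
    LinearMap.BilinForm ℝ (Fin p → ℝ) :=
  LinearMap.mk₂ ℝ (fun u v => (X *ᵥ u) ⬝ᵥ (X *ᵥ v) / n - u ⬝ᵥ v / 2)
    (fun u v w => by simp [Matrix.mulVec_add, add_dotProduct]; ring)
    (fun c u v => by simp [Matrix.mulVec_smul]; ring)
    (fun u v w => by simp [Matrix.mulVec_add, dotProduct_add]; ring)
    (fun c u v => by simp [Matrix.mulVec_smul]; ring)

theorem excessForm_self {n p : ℕ} (X : Matrix (Fin n) (Fin p) ℝ) (v : Fin p → ℝ) :
    excessForm X v v = sqNorm (X *ᵥ v) / n - sqNorm v / 2 := by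
  simp [excessForm, sqNorm, dotProduct, pow_two]

/-- Maurey's argument: sample N signed unit vectors with mean `β/‖β‖₁`. The averaged form is
`N(N-1)` times its value at the mean plus N diagonal terms, each at most 8 by the column bound.
Multiplying by `‖β‖₁²/N` gives the claim. -/
theorem sqNorm_mulVec_ge_of_signedSum {n p N : ℕ} (X : Matrix (Fin n) (Fin p) ℝ)
    (hnet : ∀ J : Fin N → Fin p × Bool,
      sqNorm (signedSum J) / 2 ≤ sqNorm (X *ᵥ signedSum J) / n)
    (hcol : ∀ j, sqNorm (X.col j) / n ≤ 8) (hN : 1 ≤ N) (β : Fin p → ℝ) :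
    0 ≤ (N - 1) * (sqNorm (X *ᵥ β) / n - sqNorm β / 2) + 8 * (∑ j, |β j|) ^ 2 := by
  set S := ∑ j, |β j| with hS
  have hS0 : 0 ≤ S := Finset.sum_nonneg fun j _ => abs_nonneg _
  have hN0 : (1 : ℝ) ≤ N := by exact_mod_cast hN
  rcases hS0.eq_or_lt with h0 | hpos
  · have : β = 0 := by
      ext j
      have := (Finset.sum_eq_zero_iff_of_nonneg fun j _ => abs_nonneg (β j)).1 h0.symm j
        (Finset.mem_univ j)
      simpa using this
    simp [this, sqNorm, ← h0]
  · let a : Fin p × Bool → Fin p → ℝ := fun x =>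
      (if x.2 then (1 : ℝ) else -1) • Pi.single x.1 (1 : ℝ)
    -- Positive parts weigh the vectors `e_j`, negative parts the vectors `-e_j`, so the mean is β
    -- divided by its ℓ₁ norm.
    let w : Fin p × Bool → ℝ := fun x => (if x.2 then (β x.1)⁺ else (β x.1)⁻) / S
    have hw : ∀ x, 0 ≤ w x := by
      intro x
      refine div_nonneg ?_ hS0
      split_ifs
      · exact posPart_nonneg _
      · exact negPart_nonneg _
    have hw1 : ∑ x, w x = 1 := by
      simp only [w, ← Finset.sum_div, Fintype.sum_prod_type, Fintype.sum_bool, if_true,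
        Bool.false_eq_true, if_false, posPart_add_negPart]
      exact div_self hpos.ne'
    have hb : ∑ x, w x • a x = S⁻¹ • β := by
      have hj : ∀ j, w (j, true) • a (j, true) + w (j, false) • a (j, false) =
          (S⁻¹ * β j) • Pi.single j (1 : ℝ) := by
        intro j
        simp only [w, a, if_true, Bool.false_eq_true, if_false, one_smul, smul_smul, ← add_smul]
        congr 1
        conv_rhs => rw [← posPart_sub_negPart (β j)]
        ring
      rw [Fintype.sum_prod_type]
      simp only [Fintype.sum_bool, hj]
      ext i
      simp [Finset.sum_apply, Pi.single_apply]
    have hB : ∀ x y, excessForm X x y = excessForm X y x := by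
      intro x y
      simp [excessForm, dotProduct_comm]
    have h := (excessForm X).average_nonneg hB a hw hw1 N 0 (fun J => by
      rw [zero_add, excessForm_self]
      have := hnet J
      simp only [signedSum] at this
      linarith)
    have ha : ∀ x, excessForm X (a x) (a x) ≤ 8 := by
      intro x
      rw [excessForm_self]
      have h1 : sqNorm (X *ᵥ a x) = sqNorm (X.col x.1) := by
        simp only [a, Matrix.mulVec_smul, sqNorm_smul, Matrix.mulVec_single_one]
        split_ifs <;> simp
      have h2 : 0 ≤ sqNorm (a x) := Finset.sum_nonneg fun _ _ => sq_nonneg _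
      rw [h1]
      linarith [hcol x.1]
    have h8 : ∑ x, w x * excessForm X (a x) (a x) ≤ 8 := by
      calc _ ≤ ∑ x, w x * 8 := by
            gcongr with x
            exact ha x
        _ = 8 := by rw [← Finset.sum_mul, hw1, one_mul]
    rw [hb] at h
    simp only [map_zero, LinearMap.zero_apply, mul_zero, zero_add, map_smul, LinearMap.smul_apply,
      smul_eq_mul, excessForm_self] at h
    have h3 : 0 ≤ N * ((N - 1) * (S⁻¹ * (S⁻¹ *
        (sqNorm (X *ᵥ β) / n - sqNorm β / 2))) + 8) := by
      simp only [← excessForm_self] at h ⊢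
      nlinarith
    have h4 := nonneg_of_mul_nonneg_right h3 (by linarith)
    have h5 := mul_nonneg h4 (sq_nonneg S)
    have h6 : ((N - 1) * (S⁻¹ * (S⁻¹ * (sqNorm (X *ᵥ β) / n - sqNorm β / 2))) + 8) * S ^ 2 =
        (N - 1) * (sqNorm (X *ᵥ β) / n - sqNorm β / 2) + 8 * S ^ 2 := by
      field_simp
    linarith

/-- On the cone the ℓ₁ norm is at most four times its part on A, and Cauchy–Schwarz on A costs a
factor √k. -/
theorem sum_abs_sq_le_of_mem_reCone {p k : ℕ} {A : Finset (Fin p)} (hA : A.card = k)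
    {β : Fin p → ℝ} (hβ : β ∈ reCone A) : (∑ j, |β j|) ^ 2 ≤ 16 * k * sqNorm β := by
  have h1 : ∑ j, |β j| ≤ 4 * ∑ j ∈ A, |β j| := by
    rw [← Finset.sum_add_sum_compl A]
    have : ∑ j ∈ Aᶜ, |β j| ≤ 3 * ∑ j ∈ A, |β j| := hβ
    linarith
  have h2 : (∑ j ∈ A, |β j|) ^ 2 ≤ k * ∑ j ∈ A, |β j| ^ 2 := by
    rw [← hA]; exact sq_sum_le_card_mul_sum_sq
  have h3 : ∑ j ∈ A, |β j| ^ 2 ≤ sqNorm β := by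
    simp only [sq_abs, sqNorm]
    exact Finset.sum_le_sum_of_subset_of_nonneg (Finset.subset_univ _) fun _ _ _ => sq_nonneg _
  calc (∑ j, |β j|) ^ 2 ≤ (4 * ∑ j ∈ A, |β j|) ^ 2 := by
        gcongr
    _ = 16 * (∑ j ∈ A, |β j|) ^ 2 := by ring
    _ ≤ 16 * (k * sqNorm β) := by gcongr; exact h2.trans (by gcongr)
    _ = _ := by ring

/-- For `sSup` to be meaningful the admissible set must be bounded above; a unit vector supported in
some k-subset lies in its cone and bounds every admissible constant. -/
theorem le_reConst {n p k : ℕ} (X : Matrix (Fin n) (Fin p) ℝ) (hk : 1 ≤ k) (hkp : k ≤ p) {γ : ℝ}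
    (h : ∀ A : Finset (Fin p), A.card = k → ∀ β ∈ reCone A,
      γ * sqNorm β ≤ sqNorm (X *ᵥ β) / n) : γ ≤ reConst X k := by
  refine le_csSup ?_ h
  obtain ⟨A, -, hA⟩ := Finset.exists_subset_card_eq
    (show k ≤ (Finset.univ : Finset (Fin p)).card by simpa using hkp)
  obtain ⟨j, hj⟩ : A.Nonempty := Finset.card_pos.1 (by omega)
  refine ⟨sqNorm (X *ᵥ Pi.single j 1) / n, fun γ' hγ' => ?_⟩
  have hmem : (Pi.single j 1 : Fin p → ℝ) ∈ reCone A := by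
    have h0 : ∑ i ∈ Aᶜ, |(Pi.single j 1 : Fin p → ℝ) i| = 0 := by
      refine Finset.sum_eq_zero fun i hi => ?_
      have : i ≠ j := by rintro rfl; exact (Finset.mem_compl.1 hi) hj
      simp [this]
    simp only [reCone, Set.mem_ofPred_eq, h0]
    exact mul_nonneg (by norm_num) (Finset.sum_nonneg fun _ _ => abs_nonneg _)
  have h1 : sqNorm (Pi.single j 1 : Fin p → ℝ) = 1 := by simp [sqNorm, Pi.single_apply]
  simpa [h1] using hγ' A hA _ hmem

/-- On the cone the error in Maurey's bound is at most 8·16k = 128k times `‖β‖²`. With `N - 1 =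
512k` it costs 1/4 of the 1/2 available on the signed sums. -/
theorem quarter_le_reConst {n p k : ℕ} (X : Matrix (Fin n) (Fin p) ℝ) (hk : 1 ≤ k) (hkp : k ≤ p)
    (hnet : ∀ J : Fin (512 * k + 1) → Fin p × Bool,
      sqNorm (signedSum J) / 2 ≤ sqNorm (X *ᵥ signedSum J) / n)
    (hcol : ∀ j, sqNorm (X.col j) / n ≤ 8) : 1 / 4 ≤ reConst X k := by
  refine le_reConst X hk hkp fun A hA β hβ => ?_
  have h1 := sqNorm_mulVec_ge_of_signedSum X hnet hcol (by omega) β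
  have h2 := sum_abs_sq_le_of_mem_reCone hA hβ
  have hk0 : (0 : ℝ) < k := by exact_mod_cast hk
  push_cast at h1
  have h3 : 0 ≤ (512 * k) * (sqNorm (X *ᵥ β) / n - sqNorm β / 2 + sqNorm β / 4) := by linarith
  have h4 := nonneg_of_mul_nonneg_right h3 (by positivity)
  linarith

/-! ### The spiked covariance model -/

section Row

variable {d : ℕ} {θ : ℝ} {u : EuclideanSpace ℝ (Fin d)}

theorem posSemidef_spiked (hθ : 0 ≤ θ) (u : EuclideanSpace ℝ (Fin d)) :
    (1 + θ • Matrix.vecMulVec u u : Matrix (Fin d) (Fin d) ℝ).PosSemidef := by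
  refine Matrix.PosSemidef.one.add (Matrix.PosSemidef.smul ?_ hθ)
  simpa using Matrix.posSemidef_vecMulVec_self_star (u : Fin d → ℝ)

theorem covariance_linear_spiked (hθ : 0 ≤ θ) (a b : Fin d → ℝ) :
    cov[fun x : EuclideanSpace ℝ (Fin d) => ∑ j, a j * x j, fun x => ∑ j, b j * x j;
      multivariateGaussian 0 (1 + θ • Matrix.vecMulVec u u)] =
      a ⬝ᵥ b + θ * ((a ⬝ᵥ u) * (b ⬝ᵥ u)) := by
  have h : ∀ a : Fin d → ℝ, (fun x : EuclideanSpace ℝ (Fin d) => ∑ j, a j * x j) =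
      fun x => inner ℝ (WithLp.toLp 2 a) x := by
    intro a
    ext x
    simp [PiLp.inner_apply, mul_comm]
  rw [h, h, ← covarianceBilin_apply_eq_cov IsGaussian.memLp_two_id,
    covarianceBilin_multivariateGaussian (posSemidef_spiked hθ u)]
  simp only [Matrix.add_mulVec, Matrix.one_mulVec, dotProduct_add, Matrix.smul_mulVec,
    dotProduct_smul, Matrix.vecMulVec_mulVec, smul_eq_mul]
  rw [dotProduct_comm (u : Fin d → ℝ) b]
  simp

theorem map_linear_spiked (hθ : 0 ≤ θ) (a : Fin d → ℝ) {σ : ℝ≥0}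
    (hσ : (σ : ℝ) ^ 2 = a ⬝ᵥ a + θ * (a ⬝ᵥ u) ^ 2) :
    (multivariateGaussian 0 (1 + θ • Matrix.vecMulVec u u)).map
      (fun x : EuclideanSpace ℝ (Fin d) => ∑ j, a j * x j) = gaussianReal 0 (σ ^ 2) := by
  have h : (fun x : EuclideanSpace ℝ (Fin d) => ∑ j, a j * x j) =
      innerSL ℝ (WithLp.toLp 2 a : EuclideanSpace ℝ (Fin d)) := by
    ext x
    simp [PiLp.inner_apply, mul_comm]
  have hv := covariance_linear_spiked (u := u) hθ a a
  rw [covariance_self (by fun_prop)] at hv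
  rw [h] at hv ⊢
  rw [IsGaussian.map_eq_gaussianReal, hv, ContinuousLinearMap.integral_comp_id_comm
    IsGaussian.integrable_id, integral_id_multivariateGaussian, map_zero]
  congr 1
  ext
  rw [Real.coe_toNNReal _ (by nlinarith [sq_nonneg (σ : ℝ)]), NNReal.coe_pow, hσ]
  ring

theorem map_linear_spikedLaw (n : ℕ) (hθ : 0 ≤ θ) (a : Fin d → ℝ) {σ : ℝ≥0}
    (hσ : (σ : ℝ) ^ 2 = a ⬝ᵥ a + θ * (a ⬝ᵥ u) ^ 2) :
    (spikedLaw n θ u).map (fun x t => ∑ j, a j * x t j) = noiseLaw n σ := by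
  unfold spikedLaw noiseLaw
  rw [← map_linear_spiked hθ a hσ]
  exact Measure.pi_map_pi (f := fun _ (x : EuclideanSpace ℝ (Fin d)) => ∑ j, a j * x j)
    fun _ => by fun_prop

instance (n : ℕ) : IsProbabilityMeasure (spikedLaw n θ u) := by
  unfold spikedLaw; infer_instance

theorem spikedLaw_linear_lower_tail (n : ℕ) (hθ : 0 ≤ θ) (a : Fin d → ℝ) :
    (spikedLaw n θ u).real {x | sqNorm (fun t => ∑ j, a j * x t j) <
      n / 2 * (a ⬝ᵥ a + θ * (a ⬝ᵥ u) ^ 2)} ≤ Real.exp (-(n / 22)) := by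
  have hV : 0 ≤ a ⬝ᵥ a + θ * (a ⬝ᵥ u) ^ 2 :=
    add_nonneg (Finset.sum_nonneg fun j _ => mul_self_nonneg _) (by positivity)
  set V := a ⬝ᵥ a + θ * (a ⬝ᵥ u) ^ 2 with hVdef
  -- The noise tail needs positive variance; for V = 0 the strict inequality makes the event empty.
  rcases hV.eq_or_lt with h0 | hpos
  · have : {x : Fin n → EuclideanSpace ℝ (Fin d) | sqNorm (fun t => ∑ j, a j * x t j) <
        n / 2 * V} = ∅ := by
      ext x
      simp only [← h0, Set.mem_ofPred_eq, mul_zero, Set.mem_empty_iff_false, iff_false, not_lt]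
      exact Finset.sum_nonneg fun _ _ => sq_nonneg _
    rw [this]
    simp [Real.exp_nonneg]
  · let σ : ℝ≥0 := NNReal.sqrt V.toNNReal
    have hσ2 : (σ : ℝ) ^ 2 = V := by
      simp [σ, Real.sq_sqrt hV, hV]
    have hσ : 0 < σ := by simpa [σ] using hpos
    refine le_trans ?_ (noiseLaw_sqNorm_lower_tail n hσ)
    rw [← map_linear_spikedLaw n hθ a hσ2, map_measureReal_apply (by fun_prop)
      (measurableSet_le (by fun_prop) (by fun_prop)), hσ2]
    refine measureReal_mono fun x hx => ?_
    rw [Set.mem_ofPred_eq] at hx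
    exact hx.le

theorem spikedLaw_linear_upper_tail (n : ℕ) (hθ : 0 ≤ θ) (a : Fin d → ℝ)
    (hV : 0 < a ⬝ᵥ a + θ * (a ⬝ᵥ u) ^ 2) :
    (spikedLaw n θ u).real {x | 4 * n * (a ⬝ᵥ a + θ * (a ⬝ᵥ u) ^ 2) ≤
      sqNorm (fun t => ∑ j, a j * x t j)} ≤ Real.exp (-(n / 22)) := by
  set V := a ⬝ᵥ a + θ * (a ⬝ᵥ u) ^ 2 with hVdef
  let σ : ℝ≥0 := NNReal.sqrt V.toNNReal
  have hσ2 : (σ : ℝ) ^ 2 = V := by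
    simp [σ, Real.sq_sqrt hV.le, hV.le]
  have hσ : 0 < σ := by simpa [σ] using hV
  refine le_trans ?_ (noiseLaw_sqNorm_upper_tail n hσ)
  rw [← map_linear_spikedLaw n hθ a hσ2, map_measureReal_apply (by fun_prop)
    (measurableSet_le (by fun_prop) (by fun_prop)), hσ2]
  exact measureReal_mono fun x hx => hx

end Row

/-! ### Regressing one coordinate on the others -/

section Regression

variable {p : ℕ}

/-- The coefficients of the regression of coordinate `i` on the other coordinates. -/
noncomputable def regCoef (θ : ℝ) (u : Fin (p + 1) → ℝ) (i : Fin (p + 1)) : Fin p → ℝ :=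
  fun j => θ * u i / (1 + θ * (1 - u i ^ 2)) * u (i.succAbove j)

/-- The residual variance of the regression of coordinate `i` on the other coordinates. -/
noncomputable def regVar (θ : ℝ) (u : Fin (p + 1) → ℝ) (i : Fin (p + 1)) : ℝ :=
  1 + θ * u i ^ 2 / (1 + θ * (1 - u i ^ 2))

/-- The other coordinates. -/
def otherCoords (i : Fin (p + 1)) (x : EuclideanSpace ℝ (Fin (p + 1))) : Fin p → ℝ :=
  fun j => x (i.succAbove j)

/-- The residual of the regression of coordinate `i` on the other coordinates. -/
noncomputable def regResidual (θ : ℝ) (u : Fin (p + 1) → ℝ) (i : Fin (p + 1))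
    (x : EuclideanSpace ℝ (Fin (p + 1))) : ℝ :=
  x i - ∑ j, regCoef θ u i j * x (i.succAbove j)

theorem regResidual_eq (θ : ℝ) (u : Fin (p + 1) → ℝ) (i : Fin (p + 1)) :
    regResidual θ u i = fun x => ∑ j, (i.insertNth 1 (-regCoef θ u i) : Fin (p + 1) → ℝ) j * x j := by
  ext x
  rw [Fin.sum_univ_succAbove _ i]
  simp [regResidual, sub_eq_add_neg]

theorem otherCoords_eq (i : Fin (p + 1)) (j : Fin p) :
    (fun x => otherCoords i x j) =
      fun x => ∑ l, (Pi.single (i.succAbove j) 1 : Fin (p + 1) → ℝ) l * x l := by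
  ext x
  simp [otherCoords, Pi.single_apply]

@[fun_prop]
theorem measurable_otherCoords (i : Fin (p + 1)) : Measurable (otherCoords i) := by
  unfold otherCoords; fun_prop

@[fun_prop]
theorem measurable_regResidual (θ : ℝ) (u : Fin (p + 1) → ℝ) (i : Fin (p + 1)) :
    Measurable (regResidual θ u i) := by
  unfold regResidual; fun_prop

variable {θ : ℝ} {u : EuclideanSpace ℝ (Fin (p + 1))}

theorem sum_sq_succAbove (hu : ‖u‖ = 1) (i : Fin (p + 1)) :
    ∑ j, u (i.succAbove j) ^ 2 = 1 - u i ^ 2 := by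
  have h := EuclideanSpace.real_norm_sq_eq u
  rw [hu, Fin.sum_univ_succAbove _ i] at h
  linarith

theorem sq_apply_le_one (hu : ‖u‖ = 1) (i : Fin (p + 1)) : u i ^ 2 ≤ 1 := by
  have h := sum_sq_succAbove hu i
  have : 0 ≤ ∑ j, u (i.succAbove j) ^ 2 := Finset.sum_nonneg fun _ _ => sq_nonneg _
  linarith

theorem regDenom_pos (hθ : 0 ≤ θ) (hu : ‖u‖ = 1) (i : Fin (p + 1)) :
    0 < 1 + θ * (1 - u i ^ 2) := by
  have := mul_nonneg hθ (sub_nonneg.2 (sq_apply_le_one hu i))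
  linarith

theorem regCoef_dotProduct_self (hu : ‖u‖ = 1) (i : Fin (p + 1)) :
    ∑ j, regCoef θ u i j ^ 2 = (θ * u i / (1 + θ * (1 - u i ^ 2))) ^ 2 * (1 - u i ^ 2) := by
  simp only [regCoef, mul_pow]
  rw [← Finset.mul_sum, sum_sq_succAbove hu]

theorem regCoef_dotProduct (hu : ‖u‖ = 1) (i : Fin (p + 1)) :
    ∑ j, regCoef θ u i j * u (i.succAbove j) =
      θ * u i / (1 + θ * (1 - u i ^ 2)) * (1 - u i ^ 2) := by
  simp only [regCoef, mul_assoc]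
  rw [← Finset.mul_sum, ← sum_sq_succAbove hu]
  simp only [pow_two]

theorem insertNth_dotProduct (i : Fin (p + 1)) (a : ℝ) (v : Fin p → ℝ) (b : Fin (p + 1) → ℝ) :
    (i.insertNth a v : Fin (p + 1) → ℝ) ⬝ᵥ b = a * b i + ∑ j, v j * b (i.succAbove j) := by
  rw [dotProduct, Fin.sum_univ_succAbove _ i]
  simp

theorem map_regResidual (hθ : 0 ≤ θ) (hu : ‖u‖ = 1) (i : Fin (p + 1)) {σ : ℝ≥0}
    (hσ : (σ : ℝ) ^ 2 = regVar θ u i) :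
    (multivariateGaussian 0 (1 + θ • Matrix.vecMulVec u u)).map (regResidual θ u i) =
      gaussianReal 0 (σ ^ 2) := by
  rw [regResidual_eq]
  refine map_linear_spiked hθ _ ?_
  rw [hσ, insertNth_dotProduct, insertNth_dotProduct]
  simp only [Fin.insertNth_apply_same, Fin.insertNth_apply_succAbove, Pi.neg_apply, neg_mul,
    ← pow_two, neg_sq, Finset.sum_neg_distrib, regCoef_dotProduct hu, regCoef_dotProduct_self hu]
  have := (regDenom_pos hθ hu i).ne'
  rw [regVar]
  field_simp
  ring

/-- These are the normal equations: with v the vector u without coordinate i, `regCoef` solves `(I +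
θvvᵀ) b = θ u_i v`, and `‖v‖² = 1 - u_i²`. -/
theorem covariance_otherCoords_regResidual (hθ : 0 ≤ θ) (hu : ‖u‖ = 1) (i : Fin (p + 1))
    (j : Fin p) : cov[fun x => otherCoords i x j, regResidual θ u i;
      multivariateGaussian 0 (1 + θ • Matrix.vecMulVec u u)] = 0 := by
  rw [regResidual_eq, otherCoords_eq, covariance_linear_spiked hθ, insertNth_dotProduct]
  simp only [single_dotProduct, Fin.insertNth_apply_succAbove, Pi.neg_apply, neg_mul,
    Finset.sum_neg_distrib, regCoef_dotProduct hu]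
  have := (regDenom_pos hθ hu i).ne'
  rw [regCoef]
  field_simp
  ring

/-- Jointly Gaussian and uncorrelated, hence independent. The residual is treated as a family
indexed by `Unit` because the criterion concerns two families of coordinates. -/
theorem indepFun_otherCoords_regResidual (hθ : 0 ≤ θ) (hu : ‖u‖ = 1) (i : Fin (p + 1)) :
    IndepFun (otherCoords i) (regResidual θ u i)
      (multivariateGaussian 0 (1 + θ • Matrix.vecMulVec u u)) := by
  let L : EuclideanSpace ℝ (Fin (p + 1)) →L[ℝ] (Fin p → ℝ) × (Unit → ℝ) :=
    (ContinuousLinearMap.pi fun j => EuclideanSpace.proj (i.succAbove j)).prod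
      (ContinuousLinearMap.pi fun _ => EuclideanSpace.proj i -
        ∑ j, regCoef θ u i j • EuclideanSpace.proj (i.succAbove j))
  have hL : (fun x => L x) = fun x => (fun j => otherCoords i x j,
      fun _ : Unit => regResidual θ u i x) := by
    ext x j
    · rfl
    · simp [L, regResidual]
  have hg : HasGaussianLaw (fun x => (fun j => otherCoords i x j,
      fun _ : Unit => regResidual θ u i x))
      (multivariateGaussian 0 (1 + θ • Matrix.vecMulVec u u)) := by
    rw [← hL]
    exact (IsGaussian.hasGaussianLaw_id
      (μ := multivariateGaussian 0 (1 + θ • Matrix.vecMulVec u u))).map_fun L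
  have h := hg.indepFun_of_covariance_eval (X := fun j x => otherCoords i x j)
    (Y := fun _ x => regResidual θ u i x) fun j _ =>
      covariance_otherCoords_regResidual hθ hu i j
  exact h.comp (φ := id) (ψ := fun f : Unit → ℝ => f ()) measurable_id (by fun_prop)

/-- Independence within each row is lifted to the whole sample by exchanging a product of pairs for
a pair of products. -/
theorem map_otherCoords_regResidual (n : ℕ) (hθ : 0 ≤ θ) (hu : ‖u‖ = 1) (i : Fin (p + 1)) {σ : ℝ≥0}
    (hσ : (σ : ℝ) ^ 2 = regVar θ u i) :
    (spikedLaw n θ u).map (fun x => (fun t => otherCoords i (x t),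
      fun t => regResidual θ u i (x t))) =
      ((spikedLaw n θ u).map fun x t => otherCoords i (x t)).prod (noiseLaw n σ) := by
  have h1 : (multivariateGaussian 0 (1 + θ • Matrix.vecMulVec u u)).map
      (fun x => (otherCoords i x, regResidual θ u i x)) =
      ((multivariateGaussian 0 (1 + θ • Matrix.vecMulVec u u)).map (otherCoords i)).prod
        (gaussianReal 0 (σ ^ 2)) := by
    rw [← map_regResidual hθ hu i hσ]
    exact (indepFun_iff_map_prod_eq_prod_map_map (by fun_prop) (by fun_prop)).1
      (indepFun_otherCoords_regResidual hθ hu i)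
  have : IsProbabilityMeasure ((multivariateGaussian 0
      (1 + θ • Matrix.vecMulVec u u)).map (otherCoords i)) :=
    Measure.isProbabilityMeasure_map (by fun_prop)
  have h2 := (measurePreserving_arrowProdEquivProdArrow (Fin p → ℝ) ℝ (Fin n)
    (fun _ => (multivariateGaussian 0 (1 + θ • Matrix.vecMulVec u u)).map (otherCoords i))
    (fun _ => gaussianReal 0 (σ ^ 2))).map_eq
  have h3 : (spikedLaw n θ u).map (fun x t => otherCoords i (x t)) =
      Measure.pi fun _ => (multivariateGaussian 0
        (1 + θ • Matrix.vecMulVec u u)).map (otherCoords i) :=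
    Measure.pi_map_pi (f := fun _ => otherCoords i) fun _ => by fun_prop
  have : IsProbabilityMeasure ((multivariateGaussian 0
      (1 + θ • Matrix.vecMulVec u u)).map (fun x => (otherCoords i x, regResidual θ u i x))) :=
    Measure.isProbabilityMeasure_map (by fun_prop)
  have h4 : (spikedLaw n θ u).map (fun x t => (otherCoords i (x t), regResidual θ u i (x t))) =
      Measure.pi fun _ => (multivariateGaussian 0
        (1 + θ • Matrix.vecMulVec u u)).map (fun x => (otherCoords i x, regResidual θ u i x)) :=
    Measure.pi_map_pi (f := fun _ x => (otherCoords i x, regResidual θ u i x))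
      fun _ => by fun_prop
  rw [h3, noiseLaw, ← h2, ← h1, ← h4, Measure.map_map (MeasurableEquiv.measurable _) (by fun_prop)]
  rfl

/-- Conditioning on the other columns: bound a probability by the worst case over good designs. -/
theorem spikedLaw_le_of_fixed_design {n : ℕ} (hθ : 0 ≤ θ) (hu : ‖u‖ = 1) (i : Fin (p + 1))
    {σ : ℝ≥0} (hσ : (σ : ℝ) ^ 2 = regVar θ u i)
    {bad : Set ((Fin n → Fin p → ℝ) × (Fin n → ℝ))} (hbad : MeasurableSet bad)
    {good : Set (Fin n → Fin p → ℝ)} (hgood : MeasurableSet good) {δ : ℝ}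
    (h : ∀ Z ∈ good, (noiseLaw n σ).real {w | (Z, w) ∈ bad} ≤ δ) :
    (spikedLaw n θ u).real {x | (fun t => otherCoords i (x t),
      fun t => regResidual θ u i (x t)) ∈ bad} ≤
      (spikedLaw n θ u).real {x | (fun t => otherCoords i (x t)) ∉ good} + max δ 0 := by
  have hm : Measurable fun x : Fin n → EuclideanSpace ℝ (Fin (p + 1)) =>
      (fun t => otherCoords i (x t)) := by fun_prop
  have : IsProbabilityMeasure ((spikedLaw n θ u).map fun x t => otherCoords i (x t)) :=
    Measure.isProbabilityMeasure_map hm.aemeasurable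
  have h1 : {x | (fun t => otherCoords i (x t), fun t => regResidual θ u i (x t)) ∈ bad} ⊆
      {x : Fin n → EuclideanSpace ℝ (Fin (p + 1)) | (fun t => otherCoords i (x t)) ∉ good} ∪
      {x | (fun t => otherCoords i (x t), fun t => regResidual θ u i (x t)) ∈
        bad ∩ Prod.fst ⁻¹' good} := by
    intro x hx
    by_cases hg : (fun t => otherCoords i (x t)) ∈ good
    · exact Or.inr ⟨hx, hg⟩
    · exact Or.inl hg
  refine (measureReal_mono h1).trans ((measureReal_union_le _ _).trans ?_)
  gcongr
  have hb : MeasurableSet (bad ∩ Prod.fst ⁻¹' good) := hbad.inter (measurable_fst hgood)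
  have h2 := map_measureReal_apply (μ := spikedLaw n θ u) (f := fun x => (fun t =>
    otherCoords i (x t), fun t => regResidual θ u i (x t))) (by fun_prop) hb
  rw [map_otherCoords_regResidual n hθ hu i hσ] at h2
  refine (le_of_eq h2.symm).trans ?_
  rw [measureReal_def]
  -- When `good` is empty, the hypothesis does not force δ to be nonnegative; hence the `max`.
  refine ENNReal.toReal_le_of_le_ofReal (le_max_right _ _) ?_
  rw [Measure.prod_apply hb]
  calc ∫⁻ Z, noiseLaw n σ (Prod.mk Z ⁻¹' (bad ∩ Prod.fst ⁻¹' good))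
        ∂((spikedLaw n θ u).map fun x t => otherCoords i (x t))
      ≤ ∫⁻ _, ENNReal.ofReal (max δ 0)
        ∂((spikedLaw n θ u).map fun x t => otherCoords i (x t)) := by
        refine lintegral_mono fun Z => ?_
        by_cases hZ : Z ∈ good
        · rw [← ofReal_measureReal]
          refine ENNReal.ofReal_le_ofReal (le_trans ?_ ((h Z hZ).trans (le_max_left _ _)))
          exact measureReal_mono fun w hw => hw.1
        · have : Prod.mk Z ⁻¹' (bad ∩ Prod.fst ⁻¹' good) = ∅ := by
            ext w; simp [hZ]
          simp [this]
    _ = _ := by simp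

end Regression

/-! ### The statistic of one coordinate under the spiked covariance model -/

/-- The statistic of a response `Zb + w`, as a function of design and noise. -/
noncomputable def pairStat (slr : SLRSolver) {n p : ℕ} (k : ℕ) (b : Fin p → ℝ)
    (q : (Fin n → Fin p → ℝ) × (Fin n → ℝ)) : ℝ :=
  sqNorm (Matrix.of q.1 *ᵥ b + q.2) / n - sqNorm (Matrix.of q.1 *ᵥ b + q.2 -
    Matrix.of q.1 *ᵥ slr n p (Matrix.of q.1 *ᵥ b + q.2) (Matrix.of q.1) k) / n

theorem measurable_mulVec {α : Type*} [MeasurableSpace α] {n p : ℕ} {Z : α → Fin n → Fin p → ℝ}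
    {b : α → Fin p → ℝ} (hZ : Measurable Z) (hb : Measurable b) :
    Measurable fun x => Matrix.of (Z x) *ᵥ b x := by
  refine measurable_pi_lambda _ fun t => ?_
  simp only [Matrix.mulVec, dotProduct, Matrix.of_apply]
  fun_prop

theorem measurable_pairStat {slr : SLRSolver} (hs : slr.IsMeasurable) {n p : ℕ} (k : ℕ)
    (b : Fin p → ℝ) : Measurable (pairStat slr (n := n) k b) := by
  have h1 : Measurable fun q : (Fin n → Fin p → ℝ) × (Fin n → ℝ) =>
      Matrix.of q.1 *ᵥ b + q.2 :=
    (measurable_mulVec measurable_fst measurable_const).add measurable_snd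
  have h2 : Measurable fun q : (Fin n → Fin p → ℝ) × (Fin n → ℝ) =>
      slr n p (Matrix.of q.1 *ᵥ b + q.2) (Matrix.of q.1) k :=
    (hs n p k).comp (h1.prodMk measurable_fst)
  have h3 := h1.sub (measurable_mulVec measurable_fst h2)
  exact ((measurable_sqNorm.comp h1).div_const _).sub ((measurable_sqNorm.comp h3).div_const _)

variable {p : ℕ} {θ : ℝ} {u : EuclideanSpace ℝ (Fin (p + 1))}

/-- This exposes the statistic as a function of two independent objects, the remaining columns and
the residual vector. -/
theorem qStat_dataMatrix (slr : SLRSolver) {n : ℕ} (k : ℕ) (i : Fin (p + 1)) (θ : ℝ)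
    (u : Fin (p + 1) → ℝ) (x : Fin n → EuclideanSpace ℝ (Fin (p + 1))) :
    qStat slr (dataMatrix x) k i = pairStat slr k (regCoef θ u i)
      (fun t => otherCoords i (x t), fun t => regResidual θ u i (x t)) := by
  have h : (dataMatrix x).col i = Matrix.of (fun t => otherCoords i (x t)) *ᵥ regCoef θ u i +
      fun t => regResidual θ u i (x t) := by
    ext t
    simp [dataMatrix, Matrix.col, Matrix.mulVec, dotProduct, otherCoords, regResidual, mul_comm]
  rw [qStat, pairStat, h]
  rfl

/-- For `u_i = 0` the regression coefficients vanish and the residual variance is 1. Every design is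
good here, since the fixed-design bound needs no restricted eigenvalue. -/
theorem qStat_null {slr : SLRSolver} (hm : slr.IsMeasurable)
    (hs : ∀ (n p k : ℕ) (y : Fin n → ℝ) (X : Matrix (Fin n) (Fin p) ℝ),
      IsSparse k (slr n p y X k)) {n k : ℕ} (hn : 1 ≤ n) (hk : 1 ≤ k) (hkp : k ≤ p)
    {L : ℝ} (hL : 1 ≤ L) (hp : (p : ℝ) / k ≤ Real.exp L) (hθ : 0 ≤ θ) (hu : ‖u‖ = 1)
    {i : Fin (p + 1)} (hi : u i = 0) :
    (spikedLaw n θ u).real {x | 13 * k * L / n < qStat slr (dataMatrix x) k i} ≤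
      Real.exp (-(2 * k * L)) := by
  have hb : regCoef θ u i = 0 := by ext j; simp [regCoef, hi]
  have h := spikedLaw_le_of_fixed_design (n := n) hθ hu i (σ := 1) (by simp [regVar, hi])
    (bad := {q | 13 * k * L / n < pairStat slr k (regCoef θ u i) q})
    (measurableSet_lt measurable_const (measurable_pairStat hm k _))
    (good := Set.univ) MeasurableSet.univ (δ := Real.exp (-(2 * k * L))) (fun Z _ => by
      have := qStat_null_fixed_design hs hn hk hkp hL hp (Matrix.of Z)
      simpa [pairStat, hb] using this)
  simp only [qStat_dataMatrix slr k i θ u]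
  refine h.trans (le_of_eq ?_)
  simp [Real.exp_nonneg]

/-- The designs for which the restricted eigenvalue is large and the signal is strong. -/
def goodDesigns (n k : ℕ) (b : Fin p → ℝ) (τ : ℝ) : Set (Fin n → Fin p → ℝ) :=
  ((⋂ J : Fin (512 * k + 1) → Fin p × Bool, {Z | n / 2 * sqNorm (signedSum J) ≤
      sqNorm (Matrix.of Z *ᵥ signedSum J)}) ∩
    ⋂ j : Fin p, {Z | sqNorm ((Matrix.of Z).col j) ≤ 8 * n}) ∩
  {Z | n / 2 * τ ≤ sqNorm (Matrix.of Z *ᵥ b)}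

theorem measurableSet_goodDesigns (n k : ℕ) (b : Fin p → ℝ) (τ : ℝ) :
    MeasurableSet (goodDesigns n k b τ) := by
  have h : ∀ v : Fin p → ℝ, Measurable fun Z : Fin n → Fin p → ℝ =>
      sqNorm (Matrix.of Z *ᵥ v) := fun v =>
    measurable_sqNorm.comp (measurable_mulVec measurable_id measurable_const)
  refine ((MeasurableSet.iInter fun J => measurableSet_le measurable_const (h _)).inter
    (MeasurableSet.iInter fun j => measurableSet_le ?_ measurable_const)).inter
    (measurableSet_le measurable_const (h _))
  simp only [← Matrix.mulVec_single_one]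
  exact h _

theorem otherCoords_mulVec {n : ℕ} (i : Fin (p + 1)) (v : Fin p → ℝ)
    (x : Fin n → EuclideanSpace ℝ (Fin (p + 1))) :
    Matrix.of (fun t => otherCoords i (x t)) *ᵥ v =
      fun t => ∑ j, (i.insertNth 0 v : Fin (p + 1) → ℝ) j * x t j := by
  ext t
  rw [Fin.sum_univ_succAbove _ i]
  simp [Matrix.mulVec, dotProduct, otherCoords, mul_comm]

/-- The bound on τ is by the variance of one entry of the product. The net vectors only need τ equal
to their squared norm; the signal uses the full variance. -/
theorem spikedLaw_mulVec_lower_tail (n : ℕ) (hθ : 0 ≤ θ) (i : Fin (p + 1)) (v : Fin p → ℝ) {τ : ℝ}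
    (hτ : τ ≤ sqNorm v + θ * (∑ j, v j * u (i.succAbove j)) ^ 2) :
    (spikedLaw n θ u).real {x | ¬ n / 2 * τ ≤
      sqNorm (Matrix.of (fun t => otherCoords i (x t)) *ᵥ v)} ≤ Real.exp (-(n / 22)) := by
  refine le_trans (measureReal_mono fun x hx => ?_)
    (spikedLaw_linear_lower_tail (u := u) n hθ (i.insertNth 0 v))
  rw [Set.mem_ofPred_eq, otherCoords_mulVec, not_le] at hx
  refine hx.trans_le ?_
  gcongr
  refine hτ.trans (le_of_eq ?_)
  rw [insertNth_dotProduct, insertNth_dotProduct]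
  simp [sqNorm, pow_two]

theorem spikedLaw_col_upper_tail (n : ℕ) (hθ : 0 ≤ θ) (hθ1 : θ ≤ 1) (hu : ‖u‖ = 1)
    (i : Fin (p + 1)) (j : Fin p) :
    (spikedLaw n θ u).real {x | ¬ sqNorm ((Matrix.of (fun t => otherCoords i (x t))).col j) ≤
      8 * n} ≤ Real.exp (-(n / 22)) := by
  have hv : (i.insertNth 0 (Pi.single j 1) : Fin (p + 1) → ℝ) ⬝ᵥ
      (i.insertNth 0 (Pi.single j 1) : Fin (p + 1) → ℝ) + θ *
      ((i.insertNth 0 (Pi.single j 1) : Fin (p + 1) → ℝ) ⬝ᵥ u) ^ 2 =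
      1 + θ * u (i.succAbove j) ^ 2 := by
    rw [insertNth_dotProduct, insertNth_dotProduct]
    simp [Pi.single_apply]
  have h2 := sq_apply_le_one hu (i.succAbove j)
  have h3 : θ * u (i.succAbove j) ^ 2 ≤ 1 := mul_le_one₀ hθ1 (sq_nonneg _) h2
  refine le_trans (measureReal_mono fun x hx => ?_)
    (spikedLaw_linear_upper_tail (u := u) n hθ (i.insertNth 0 (Pi.single j 1)) (by
      rw [hv]; positivity))
  rw [Set.mem_ofPred_eq, ← Matrix.mulVec_single_one, otherCoords_mulVec, not_le] at hx
  rw [Set.mem_ofPred_eq, hv]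
  refine le_trans ?_ hx.le
  nlinarith [(Nat.cast_nonneg n : (0 : ℝ) ≤ n)]

theorem spikedLaw_not_goodDesigns (n k : ℕ) (hθ : 0 ≤ θ) (hθ1 : θ ≤ 1) (hu : ‖u‖ = 1)
    (i : Fin (p + 1)) (b : Fin p → ℝ) {τ : ℝ}
    (hτ : τ ≤ sqNorm b + θ * (∑ j, b j * u (i.succAbove j)) ^ 2) :
    (spikedLaw n θ u).real {x | (fun t => otherCoords i (x t)) ∉ goodDesigns n k b τ} ≤
      ((2 * p) ^ (512 * k + 1) + p + 1) * Real.exp (-(n / 22)) := by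
  have hsub : {x : Fin n → EuclideanSpace ℝ (Fin (p + 1)) |
      (fun t => otherCoords i (x t)) ∉ goodDesigns n k b τ} ⊆
      ((⋃ J : Fin (512 * k + 1) → Fin p × Bool, {x | ¬ n / 2 * sqNorm (signedSum J) ≤
        sqNorm (Matrix.of (fun t => otherCoords i (x t)) *ᵥ signedSum J)}) ∪
      ⋃ j : Fin p, {x | ¬ sqNorm ((Matrix.of (fun t => otherCoords i (x t))).col j) ≤ 8 * n}) ∪
      {x | ¬ n / 2 * τ ≤ sqNorm (Matrix.of (fun t => otherCoords i (x t)) *ᵥ b)} := by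
    intro x hx
    simp only [Set.mem_ofPred_eq, goodDesigns, Set.mem_inter_iff, Set.mem_iInter,
      not_and_or, not_forall] at hx
    simpa only [Set.mem_union, Set.mem_iUnion, Set.mem_ofPred_eq] using hx
  refine (measureReal_mono hsub).trans ((measureReal_union_le _ _).trans ?_)
  rw [add_one_mul (α := ℝ)]
  refine add_le_add ((measureReal_union_le _ _).trans ?_)
    (spikedLaw_mulVec_lower_tail n hθ i b hτ)
  rw [add_mul]
  refine add_le_add ((measureReal_iUnion_fintype_le _).trans ?_)
    ((measureReal_iUnion_fintype_le _).trans ?_)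
  · refine (Finset.sum_le_card_nsmul _ _ _ fun J _ =>
      spikedLaw_mulVec_lower_tail (u := u) n hθ i (signedSum J) ?_).trans (le_of_eq ?_)
    · exact le_add_of_nonneg_right (by positivity)
    · simp [mul_comm]
  · refine (Finset.sum_le_card_nsmul _ _ _ fun j _ =>
      spikedLaw_col_upper_tail (u := u) n hθ hθ1 hu i j).trans (le_of_eq ?_)
    simp

theorem isSparse_regCoef {k : ℕ} (hu : IsSparse k u) (θ : ℝ) (i : Fin (p + 1)) :
    IsSparse k (regCoef θ u i) := by
  refine le_trans (Finset.card_le_card_of_injOn i.succAbove (fun j hj => ?_)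
    i.succAbove_right_injective.injOn) hu
  rw [Finset.mem_coe, suppF, Finset.mem_filter, regCoef] at hj
  rw [Finset.mem_coe, suppF, Finset.mem_filter]
  exact ⟨Finset.mem_univ _, right_ne_zero_of_mul hj.2⟩

/-- The fraction in `hsig` is the variance of the regression part `b · x_{-i}`, so on good designs
half of n times it bounds the squared signal norm from below. The residual variance lies in [1, 2]
because `θ ≤ 1`. -/
theorem qStat_signal {slr : SLRSolver} {c c' c'' : ℝ} (hc : 0 < c) (hc' : 0 < c')
    (hm : slr.IsMeasurable) (hs : slr.BlackBox c c' c'')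
    {n k : ℕ} (hn : 1 ≤ n) (hp2 : 2 ≤ p) (hk : 1 ≤ k) (hkp : k ≤ p) {ℓ thr : ℝ}
    (hℓ : 1 ≤ ℓ) (hpℓ : Real.log p ≤ ℓ) (hpe : (p : ℝ) ≤ Real.exp ℓ) (hthr : thr ≤ ℓ)
    (hθ : 0 ≤ θ) (hθ1 : θ ≤ 1) (hu : ‖u‖ = 1) (husp : IsSparse k u) (i : Fin (p + 1))
    (hsig : (220 + 128 * c) * (k * ℓ) ≤
      n / 2 * (θ ^ 2 * u i ^ 2 * (1 - u i ^ 2) / (1 + θ * (1 - u i ^ 2)))) :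
    (spikedLaw n θ u).real {x | qStat slr (dataMatrix x) k i ≤ 13 * k * thr / n} ≤
      ((2 * p) ^ (512 * k + 1) + p + 1) * Real.exp (-(n / 22)) +
      (c' * Real.exp (-c'' * k * Real.log p) + Real.exp (-(4 * k * ℓ))) := by
  have hn0 : (0 : ℝ) < n := by exact_mod_cast hn
  set τ := θ ^ 2 * u i ^ 2 * (1 - u i ^ 2) / (1 + θ * (1 - u i ^ 2)) with hτ
  have hden := regDenom_pos hθ hu i
  have hτeq : τ = sqNorm (regCoef θ u i) +
      θ * (∑ j, regCoef θ u i j * u (i.succAbove j)) ^ 2 := by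
    rw [sqNorm, regCoef_dotProduct_self hu, regCoef_dotProduct hu, hτ]
    field_simp
  have hvar0 : 0 ≤ u i ^ 2 := sq_nonneg _
  have hvar1 := sq_apply_le_one hu i
  have hvarpos : 1 ≤ regVar θ u i := by
    rw [regVar]
    have : 0 ≤ θ * u i ^ 2 / (1 + θ * (1 - u i ^ 2)) := by positivity
    linarith
  have hvar2 : regVar θ u i ≤ 2 := by
    rw [regVar]
    have : θ * u i ^ 2 / (1 + θ * (1 - u i ^ 2)) ≤ 1 := by
      rw [div_le_one hden]
      nlinarith
    linarith
  have hσ : ((NNReal.sqrt (regVar θ u i).toNNReal : ℝ≥0) : ℝ) ^ 2 = regVar θ u i := by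
    rw [← NNReal.coe_pow, NNReal.sq_sqrt, Real.coe_toNNReal _ (by linarith)]
  have hσ0 : 0 < NNReal.sqrt (regVar θ u i).toNNReal := by
    simpa using (by linarith : 0 < regVar θ u i)
  set σ := NNReal.sqrt (regVar θ u i).toNNReal
  have h := spikedLaw_le_of_fixed_design (n := n) hθ hu i hσ
    (bad := {q | pairStat slr k (regCoef θ u i) q ≤ 13 * k * thr / n})
    (measurableSet_le (measurable_pairStat hm k _) measurable_const)
    (measurableSet_goodDesigns n k (regCoef θ u i) τ)
    (δ := c' * Real.exp (-c'' * k * Real.log p) + Real.exp (-(4 * k * ℓ))) (fun Z hZ => by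
      obtain ⟨⟨hZ1, hZ2⟩, hZ3⟩ := hZ
      simp only [Set.mem_iInter, Set.mem_ofPred_eq] at hZ1 hZ2 hZ3
      refine qStat_signal_fixed_design hc hm hs hn hp2 hk hkp hℓ hpℓ hpe hthr (Matrix.of Z)
        (quarter_le_reConst _ hk hkp (fun J => ?_) fun j => ?_) (isSparse_regCoef husp θ i)
        (hsig.trans hZ3) hσ0 (by rw [hσ]; exact hvar2)
      · rw [le_div_iff₀ hn0]
        linarith [hZ1 J]
      · rw [div_le_iff₀ hn0]
        exact hZ2 j)
  simp only [qStat_dataMatrix slr k i θ u]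
  refine h.trans (add_le_add (spikedLaw_not_goodDesigns n k hθ hθ1 hu i _ hτeq.le) ?_)
  exact max_le le_rfl (by positivity)

/-! ### Consequences of the assumptions on the spike -/

section Spike

variable {p k : ℕ} {u : EuclideanSpace ℝ (Fin (p + 1))} {cmin : ℝ}

theorem sparsity_pos (hu : ‖u‖ = 1) (husp : IsSparse k u) : 1 ≤ k := by
  by_contra hk
  have h0 : suppF u = ∅ := Finset.card_eq_zero.1 (by unfold IsSparse at husp; omega)
  have : ∀ i, u i = 0 := by
    intro i
    by_contra hi
    have : i ∈ suppF u := by simp [suppF, hi]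
    simp [h0] at this
  have h1 := EuclideanSpace.real_norm_sq_eq u
  simp [hu, this] at h1

/-- The coordinate given by the spread condition is nonzero and has square below 1, so some other
coordinate is nonzero. -/
theorem two_le_sparsity (hu : ‖u‖ = 1) (husp : IsSparse k u) (hc : 0 < cmin)
    (hspread : SpikeSpread k cmin u) : 2 ≤ k := by
  have hk : (0 : ℝ) < k := by exact_mod_cast sparsity_pos hu husp
  obtain ⟨i, h1, h2⟩ := hspread
  have ha : 0 < cmin ^ 2 / k := by positivity
  have h3 := sum_sq_succAbove hu i
  obtain ⟨j, -, hj⟩ := Finset.exists_ne_zero_of_sum_ne_zero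
    (show ∑ j, u (i.succAbove j) ^ 2 ≠ 0 by rw [h3]; linarith)
  have hi : u i ≠ 0 := by rintro h; rw [h] at h1; simp at h1; linarith
  have hj' : u (i.succAbove j) ≠ 0 := by simpa using hj
  refine le_trans ?_ husp
  rw [← Finset.card_pair (Fin.succAbove_ne i j).symm]
  refine Finset.card_le_card fun l hl => ?_
  rcases Finset.mem_insert.1 hl with rfl | hl
  · simp [suppF, hi]
  · rw [Finset.mem_singleton] at hl
    simp [suppF, hl, hj']

/-- The spread condition at one coordinate l serves all of the support: for i ≠ l the mass of l is
contained in `1 - u_i²`. -/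
theorem half_cmin_sq_le (hu : ‖u‖ = 1) (husp : IsSparse k u) (hc : 0 < cmin)
    (hspread : SpikeSpread k cmin u) (hmin : SpikeMin k cmin u) {i : Fin (p + 1)} (hi : u i ≠ 0) :
    cmin ^ 2 / k / 2 ≤ u i ^ 2 * (1 - u i ^ 2) := by
  have hk : (0 : ℝ) < k := by exact_mod_cast sparsity_pos hu husp
  have ha : 0 < cmin ^ 2 / k := by positivity
  have h1 : cmin ^ 2 / k ≤ u i ^ 2 := by
    have := pow_le_pow_left₀ (by positivity) (hmin i hi) 2
    rwa [div_pow, Real.sq_sqrt hk.le, sq_abs] at this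
  have h2 : cmin ^ 2 / k ≤ 1 - u i ^ 2 := by
    obtain ⟨l, hl1, hl2⟩ := hspread
    by_cases hil : l = i
    · rw [hil] at hl2; linarith
    · obtain ⟨j, rfl⟩ := Fin.exists_succAbove_eq hil
      rw [← sum_sq_succAbove hu i]
      exact hl1.trans (Finset.single_le_sum (f := fun j => u (i.succAbove j) ^ 2)
        (fun _ _ => sq_nonneg _) (Finset.mem_univ j))
  -- With x = `u_i²` and a = `cmin²/k`, the product `(x - a)(1 - x - a) ≥ 0` gives `x(1 - x) ≥ a(1 -
  -- a)`, and `a ≤ 1/2` since both x and 1 - x are at least a.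
  nlinarith [mul_nonneg (sub_nonneg.2 h1) (sub_nonneg.2 h2)]

theorem signal_variance_ge {θ : ℝ} (hθ : 0 < θ) (hθ1 : θ ≤ 1)
    (hu : ‖u‖ = 1) (husp : IsSparse k u) (hc : 0 < cmin)
    (hspread : SpikeSpread k cmin u) (hmin : SpikeMin k cmin u) {i : Fin (p + 1)} (hi : u i ≠ 0) :
    θ ^ 2 * (cmin ^ 2 / k) / 4 ≤
      θ ^ 2 * u i ^ 2 * (1 - u i ^ 2) / (1 + θ * (1 - u i ^ 2)) := by
  have h1 := half_cmin_sq_le hu husp hc hspread hmin hi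
  have h2 := sq_apply_le_one hu i
  have h3 : θ * (1 - u i ^ 2) ≤ 1 := by nlinarith [sq_nonneg (u i)]
  rw [le_div_iff₀ (regDenom_pos hθ.le hu i)]
  have h4 : 0 ≤ θ ^ 2 * (cmin ^ 2 / k) := by positivity
  have h5 := mul_le_mul_of_nonneg_left h1 (sq_nonneg θ)
  nlinarith

end Spike

/-! ### Numerical estimates -/

/-- From `log d ≥ 1 + log k` the difference of the two sides is at least `k - 1 - log k ≥ 0`. It
pays for the union bound over d coordinates in the null case. -/
theorem log_le_mul_log_div {d k : ℝ} (hk : 2 ≤ k) (hd : Real.exp 1 * k ≤ d) :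
    Real.log d ≤ k * Real.log (d / k) := by
  have hk0 : 0 < k := by linarith
  have hd0 : 0 < d := lt_of_lt_of_le (by positivity) hd
  have h1 : 1 + Real.log k ≤ Real.log d := by
    rw [← Real.log_exp 1, ← Real.log_mul (Real.exp_pos 1).ne' hk0.ne']
    exact Real.log_le_log (by positivity) hd
  have h2 := Real.log_le_sub_one_of_pos hk0
  rw [Real.log_div hd0.ne' hk0.ne']
  nlinarith

/-- With `d = e^ℓ` and `2p ≤ d²`, the number of events is at most `e^(1030kℓ)`; the constant 1034 =
1030 + 4 leaves the stated rate. -/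
theorem card_designs_mul_exp_le {p k : ℕ} {n ℓ : ℝ} (hk : 1 ≤ k) (hp : 2 ≤ p) (hℓ : 1 ≤ ℓ)
    (hd : ((p + 1 : ℕ) : ℝ) = Real.exp ℓ) (hn : 22 * 1034 * k * ℓ < n) :
    ((2 * p) ^ (512 * k + 1) + p + 1) * Real.exp (-(n / 22)) ≤ Real.exp (-(4 * k * ℓ)) := by
  have hk1 : (1 : ℝ) ≤ k := by exact_mod_cast hk
  have hp2 : (2 : ℝ) ≤ p := by exact_mod_cast hp
  push_cast at hd
  have h1 : (2 * p : ℝ) ≤ Real.exp ℓ ^ 2 := by rw [← hd]; nlinarith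
  have h2 : (2 : ℝ) ≤ Real.exp 1 := by have := Real.exp_one_gt_d9; linarith
  have h3 : (2 * p : ℝ) ^ (512 * k + 1) + p + 1 ≤ Real.exp (1030 * k * ℓ) := by
    calc (2 * p : ℝ) ^ (512 * k + 1) + p + 1
        = (2 * p : ℝ) ^ (512 * k + 1) + Real.exp ℓ := by rw [← hd]; ring
      _ ≤ (Real.exp ℓ ^ 2) ^ (512 * k + 1) + Real.exp ℓ := by gcongr
      _ = Real.exp ((1024 * k + 2) * ℓ) + Real.exp ℓ := by
          rw [← pow_mul, ← Real.exp_nat_mul]; push_cast; ring_nf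
      _ ≤ Real.exp (1029 * k * ℓ) + Real.exp (1029 * k * ℓ) := by
          gcongr
          · nlinarith
          · nlinarith
      _ = 2 * Real.exp (1029 * k * ℓ) := by ring
      _ ≤ Real.exp 1 * Real.exp (1029 * k * ℓ) := by gcongr
      _ = Real.exp (1 + 1029 * k * ℓ) := by rw [Real.exp_add]
      _ ≤ _ := by gcongr; nlinarith
  calc _ ≤ Real.exp (1030 * k * ℓ) * Real.exp (-(n / 22)) := by gcongr
    _ = Real.exp (1030 * k * ℓ - n / 22) := by rw [← Real.exp_add, sub_eq_add_neg]
    _ ≤ _ := by gcongr; linarith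

/-- Absorbs the factor k of the union bound over the support into half of the exponent; as c'' may
be small, this costs the constant `4/c''`. -/
theorem mul_exp_neg_le {c'' x y : ℝ} (hc : 0 < c'') (hxy : x ≤ y) :
    x * Real.exp (-(c'' / 2 * y)) ≤ 4 / c'' * Real.exp (-(c'' / 4 * y)) := by
  have h1 : c'' / 4 * x ≤ Real.exp (c'' / 4 * y) := by
    have := Real.add_one_le_exp (c'' / 4 * y)
    nlinarith
  have h2 : x ≤ 4 / c'' * Real.exp (c'' / 4 * y) := by
    calc x = 4 / c'' * (c'' / 4 * x) := by field_simp
      _ ≤ _ := by gcongr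
  calc x * Real.exp (-(c'' / 2 * y)) ≤
        4 / c'' * Real.exp (c'' / 4 * y) * Real.exp (-(c'' / 2 * y)) := by gcongr
    _ = _ := by rw [mul_assoc, ← Real.exp_add]; ring_nf

/-- The solver sees p = d - 1 columns, so its failure probability involves `log p`; `p + 1 ≤ p²`
converts this to `log d`. -/
theorem half_log_le {p : ℕ} (hp : 2 ≤ p) :
    Real.log ((p + 1 : ℕ) : ℝ) / 2 ≤ Real.log p := by
  have hp2 : (2 : ℝ) ≤ p := by exact_mod_cast hp
  have : Real.log ((p + 1 : ℕ) : ℝ) ≤ Real.log ((p : ℝ) ^ 2) := by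
    apply Real.log_le_log (by positivity)
    push_cast
    nlinarith
  rw [Real.log_pow] at this
  push_cast at this ⊢
  linarith

/-! ### Support recovery -/

theorem support_recovery_real {c c' c'' : ℝ} (hc : 0 < c) (hc' : 0 < c') (hc'' : 0 < c'')
    {slr : SLRSolver} (hm : slr.IsMeasurable) (hs : slr.BlackBox c c' c'')
    {n p k : ℕ} {θ cmin ε : ℝ} {u : EuclideanSpace ℝ (Fin (p + 1))}
    (hcmin : 0 < cmin) (hu : ‖u‖ = 1) (husp : IsSparse k u)
    (hspread : SpikeSpread k cmin u) (hmin : SpikeMin k cmin u)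
    (hd : Real.exp 1 * k ≤ ((p + 1 : ℕ) : ℝ)) (hε : 0 < ε)
    (hkε : (k : ℝ) ≤ ((p + 1 : ℕ) : ℝ) ^ (1 - ε)) (hθ : 0 < θ) (hθ1 : θ ≤ 1)
    (hsig : 8 * (220 + 128 * c) / cmin ^ 2 * ((k : ℝ) ^ 2 * Real.log ((p + 1 : ℕ) : ℝ) / n) < θ ^ 2)
    (hn : 22 * 1034 * k * Real.log ((p + 1 : ℕ) : ℝ) < n) :
    1 - (3 + c' * (4 / c'')) *
      Real.exp (-(min 1 (c'' / 4) * ε) * k * Real.log ((p + 1 : ℕ) : ℝ)) ≤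
      (spikedLaw n θ u).real {x | qSupport slr (dataMatrix x) k = suppF u} := by
  have hk2 := two_le_sparsity hu husp hcmin hspread
  have hk2' : (2 : ℝ) ≤ k := by exact_mod_cast hk2
  have hk0 : (0 : ℝ) < k := by linarith
  have he := Real.exp_one_gt_d9
  set d : ℝ := ((p + 1 : ℕ) : ℝ) with hddef
  have hd0 : 0 < d := by positivity
  have hdp : d = p + 1 := by rw [hddef]; push_cast; ring
  have hkp : k ≤ p := by
    have : (k : ℝ) < p + 1 := by
      have := mul_lt_mul_of_pos_right (by linarith : 1 < Real.exp 1) hk0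
      linarith
    have : k < p + 1 := by exact_mod_cast this
    omega
  have hp2 : 2 ≤ p := by omega
  set ℓ := Real.log d with hℓdef
  set L := Real.log (d / k) with hLdef
  have hdexp : d = Real.exp ℓ := (Real.exp_log hd0).symm
  have hL1 : 1 ≤ L := by
    rw [hLdef, Real.le_log_iff_exp_le (by positivity), le_div_iff₀ hk0]
    exact hd
  have hLsub : L = ℓ - Real.log k := Real.log_div hd0.ne' hk0.ne'
  have hlogk : 0 < Real.log k := Real.log_pos (by linarith)
  have hLℓ : L ≤ ℓ := by linarith
  have hℓ1 : 1 ≤ ℓ := by linarith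
  have hεL : ε * ℓ ≤ L := by
    have h := Real.log_le_log hk0 hkε
    rw [Real.log_rpow hd0] at h
    linarith
  -- Since `k ≥ 2`, `L < ℓ` strictly, while `εℓ ≤ L`.
  have hε1 : ε ≤ 1 := by
    by_contra h
    have := mul_le_mul_of_nonneg_right (not_le.1 h).le (by linarith : 0 ≤ ℓ)
    linarith
  have hkL : ℓ ≤ k * L := log_le_mul_log_div hk2' hd
  have hkℓ : 0 < k * ℓ := by positivity
  have hn0 : (0 : ℝ) < n := lt_of_le_of_lt (by positivity) hn
  have hn1 : 1 ≤ n := by exact_mod_cast hn0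
  have hpe : (p : ℝ) ≤ Real.exp ℓ := by rw [← hdexp, hdp]; linarith
  have hp0 : (0 : ℝ) < p := by exact_mod_cast (by omega : 0 < p)
  have hpℓ : Real.log p ≤ ℓ := (Real.log_le_iff_le_exp hp0).2 hpe
  have hpL : (p : ℝ) / k ≤ Real.exp L := by
    rw [hLdef, Real.exp_log (by positivity)]
    gcongr
    linarith
  -- the events on which coordinate `i` is misclassified
  let bad : Fin (p + 1) → Set (Fin n → EuclideanSpace ℝ (Fin (p + 1))) := fun i =>
    if u i = 0 then {x | 13 * k * L / n < qStat slr (dataMatrix x) k i}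
    else {x | qStat slr (dataMatrix x) k i ≤ 13 * k * L / n}
  have hsub : {x | qSupport slr (dataMatrix x) k = suppF u}ᶜ ⊆ ⋃ i, bad i := by
    intro x hx
    by_contra hcon
    refine hx ?_
    rw [Set.mem_iUnion, not_exists] at hcon
    ext i
    simp only [qSupport, suppF, Finset.mem_filter, Finset.mem_univ, true_and]
    have hi := hcon i
    by_cases hui : u i = 0
    · simp only [bad, hui, if_true, Set.mem_ofPred_eq] at hi
      simpa only [hui, ne_eq, not_true_eq_false, iff_false] using hi
    · simp only [bad, hui, if_false, Set.mem_ofPred_eq, not_le] at hi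
      simpa only [ne_eq, hui, not_false_eq_true, iff_true] using hi
  set E₀ := Real.exp (-(2 * k * L)) with hE₀
  set E₁ := Real.exp (-(4 * k * ℓ)) + (c' * Real.exp (-c'' * k * Real.log p) +
    Real.exp (-(4 * k * ℓ))) with hE₁
  -- The solver and design failures are charged only on the support, so they are multiplied by k and
  -- not by d in the union bound.
  have hbad : ∀ i, (spikedLaw n θ u).real (bad i) ≤ E₀ + if i ∈ suppF u then E₁ else 0 := by
    intro i
    by_cases hui : u i = 0
    · have h := qStat_null (n := n) hm hs.1 hn1 (by omega) hkp hL1 hpL hθ.le hu hui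
      simpa [bad, hui, suppF] using h
    · have h := qStat_signal (n := n) hc hc' hm hs hn1 hp2 (by omega) hkp hℓ1 hpℓ hpe hLℓ hθ.le
        hθ1 hu husp i (by
          have h1 := signal_variance_ge hθ hθ1 hu husp hcmin hspread hmin hui
          -- The 8 in the condition on θ is 2 from the lower tail of the signal norm times 4 from
          -- `signal_variance_ge`.
          have h2 : (220 + 128 * c) * (k * ℓ) ≤ n / 2 * (θ ^ 2 * (cmin ^ 2 / k) / 4) := by
            rw [div_mul_div_comm, div_lt_iff₀ (by positivity)] at hsig
            have h3 : n / 2 * (θ ^ 2 * (cmin ^ 2 / k) / 4) = θ ^ 2 * (cmin ^ 2 * n) / (8 * k) := by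
              field_simp
              norm_num
            rw [h3, le_div_iff₀ (by positivity)]
            linarith
          exact h2.trans (by gcongr))
      have h4 := card_designs_mul_exp_le (by omega : 1 ≤ k) hp2 hℓ1 hdexp hn
      have h5 : 0 ≤ E₀ := Real.exp_nonneg _
      have h6 : i ∈ suppF u := by simp [suppF, hui]
      simp only [bad, hui, if_false, h6, if_true]
      linarith
  have hcompl : (spikedLaw n θ u).real {x | qSupport slr (dataMatrix x) k = suppF u}ᶜ ≤
      d * E₀ + k * E₁ := by
    refine (measureReal_mono hsub).trans ((measureReal_iUnion_fintype_le _).trans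
      ((Finset.sum_le_sum fun i _ => hbad i).trans ?_))
    rw [Finset.sum_add_distrib, Finset.sum_ite_mem, Finset.univ_inter, Finset.sum_const,
      Finset.sum_const, nsmul_eq_mul, nsmul_eq_mul, Finset.card_univ, Fintype.card_fin]
    have : ((suppF u).card : ℝ) ≤ k := by exact_mod_cast husp
    gcongr
  have hone : 1 ≤ (spikedLaw n θ u).real {x | qSupport slr (dataMatrix x) k = suppF u} +
      (spikedLaw n θ u).real {x | qSupport slr (dataMatrix x) k = suppF u}ᶜ := by
    have := measureReal_union_le (μ := spikedLaw n θ u)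
      {x | qSupport slr (dataMatrix x) k = suppF u} {x | qSupport slr (dataMatrix x) k = suppF u}ᶜ
    rwa [Set.union_compl_self, probReal_univ] at this
  set m := min 1 (c'' / 4) with hmdef
  have hm1 : m ≤ 1 := min_le_left _ _
  have hm2 : m ≤ c'' / 4 := min_le_right _ _
  have hm0 : 0 < m := by positivity
  set E := Real.exp (-(m * ε) * k * ℓ) with hE
  have hmε : m * ε ≤ m := mul_le_of_le_one_right hm0.le hε1
  have hmε1 : m * ε * (k * ℓ) ≤ m * (k * ℓ) := by gcongr
  -- `d = e^ℓ ≤ e^(kL)` uses up half of the exponent 2kL, and `L ≥ εℓ` bounds the rest. This is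
  -- where ε enters the rate.
  have hnull : d * E₀ ≤ E := by
    rw [hdexp, hE₀, ← Real.exp_add]
    apply Real.exp_le_exp.2
    have h1 : k * (ε * ℓ) ≤ k * L := by gcongr
    have h2 : m * (k * (ε * ℓ)) ≤ 1 * (k * (ε * ℓ)) := by gcongr
    linarith
  have hkk : (k : ℝ) ≤ k * ℓ := le_mul_of_one_le_right hk0.le hℓ1
  have hkexp : (k : ℝ) ≤ Real.exp (k * ℓ) := by
    have := Real.add_one_le_exp (k * ℓ)
    linarith
  have hdesign : k * Real.exp (-(4 * k * ℓ)) ≤ E := by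
    calc k * Real.exp (-(4 * k * ℓ)) ≤ Real.exp (k * ℓ) * Real.exp (-(4 * k * ℓ)) := by gcongr
      _ = Real.exp (k * ℓ + -(4 * k * ℓ)) := by rw [Real.exp_add]
      _ ≤ _ := by
        apply Real.exp_le_exp.2
        have : m * (k * ℓ) ≤ 1 * (k * ℓ) := by gcongr
        linarith
  have hsolver : k * (c' * Real.exp (-c'' * k * Real.log p)) ≤ c' * (4 / c'') * E := by
    have h1 : Real.exp (-c'' * k * Real.log p) ≤ Real.exp (-(c'' / 2 * (k * ℓ))) := by
      apply Real.exp_le_exp.2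
      have h2 : ℓ / 2 ≤ Real.log p := half_log_le hp2
      have h3 := mul_le_mul_of_nonneg_left h2 (by positivity : 0 ≤ c'' * k)
      linarith
    have h4 := mul_exp_neg_le hc'' hkk
    have h5 : Real.exp (-(c'' / 4 * (k * ℓ))) ≤ E := by
      apply Real.exp_le_exp.2
      have : m * (k * ℓ) ≤ c'' / 4 * (k * ℓ) := by gcongr
      linarith
    calc k * (c' * Real.exp (-c'' * k * Real.log p))
        ≤ k * (c' * Real.exp (-(c'' / 2 * (k * ℓ)))) := by gcongr
      _ = c' * (k * Real.exp (-(c'' / 2 * (k * ℓ)))) := by ring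
      _ ≤ c' * (4 / c'' * Real.exp (-(c'' / 4 * (k * ℓ)))) := by gcongr
      _ ≤ c' * (4 / c'' * E) := by gcongr
      _ = _ := by ring
  -- Designs and projections contribute one E each; with the null coordinates this makes the 3 in
  -- the final constant.
  have : k * E₁ ≤ 2 * E + c' * (4 / c'') * E := by
    rw [hE₁]
    linarith
  linarith

/-! ### Hoare triples with running time -/

/-- Started in a state with property `P`, the program ends in a state with property `Q` after at
most `K` steps. -/
def Prog.Triple (slr : SLRSolver) (T : ℕ → ℕ → ℕ → ℕ) (P : MState → Prop) (c : Prog)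
    (Q : MState → Prop) (K : ℕ) : Prop :=
  ∀ s, P s → Q (c.run slr T s).1 ∧ (c.run slr T s).2 ≤ K

section Triple

variable {slr : SLRSolver} {T : ℕ → ℕ → ℕ → ℕ} {P Q R : MState → Prop}

theorem Prog.Triple.seq {c₁ c₂ : Prog} {K₁ K₂ : ℕ} (h₁ : Prog.Triple slr T P c₁ Q K₁)
    (h₂ : Prog.Triple slr T Q c₂ R K₂) : Prog.Triple slr T P (.seq c₁ c₂) R (K₁ + K₂) := by
  intro s hs
  obtain ⟨h3, h4⟩ := h₁ s hs
  obtain ⟨h5, h6⟩ := h₂ _ h3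
  exact ⟨h5, add_le_add h4 h6⟩

theorem Prog.Triple.mono {c : Prog} {K K' : ℕ} (h : Prog.Triple slr T P c Q K) (hK : K ≤ K') :
    Prog.Triple slr T P c Q K' :=
  fun s hs => ⟨(h s hs).1, (h s hs).2.trans hK⟩

theorem iterCost_invariant {body : ℕ → MState → MState × ℕ} {I : ℕ → MState → Prop} {K : ℕ} :
    ∀ M : ℕ, (∀ m < M, ∀ s, I m s → I (m + 1) (body m s).1 ∧ (body m s).2 ≤ K) →
      ∀ s, I 0 s → I M (iterCost body M s).1 ∧ (iterCost body M s).2 ≤ M * (K + 1)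
  | 0, _, s, hs => ⟨hs, by simp [iterCost]⟩
  | M + 1, h, s, hs => by
    obtain ⟨h1, h2⟩ := iterCost_invariant M (fun m hm => h m (by omega)) s hs
    obtain ⟨h3, h4⟩ := h M (by omega) _ h1
    exact ⟨h3, by simp only [iterCost]; linarith⟩

/-- The bound is evaluated once, so its value is needed only under `I 0`; the invariant must survive
overwriting the counter, because each round starts by doing so. -/
theorem Prog.Triple.loop {r : ℕ} {e : IdxExp} {c : Prog} {K M : ℕ} {I : ℕ → MState → Prop}
    (he : ∀ s, I 0 s → e.eval s = M)
    (hI : ∀ m x s, I m s → I m (s.setIdx r x))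
    (hc : ∀ m < M, Prog.Triple slr T (fun s => I m s ∧ s.idx r = m) c (I (m + 1)) K) :
    Prog.Triple slr T (I 0) (.loop r e c) (I M) (M * (K + 1) + e.cost + 1) := by
  intro s hs
  have h := iterCost_invariant (body := fun i s' => c.run slr T (s'.setIdx r i)) M
    (fun m hm s' hs' => hc m hm _ ⟨hI m m s' hs', by simp [MState.setIdx]⟩) s hs
  simp only [Prog.run, he s hs]
  exact ⟨h.1, by linarith [h.2]⟩

theorem Prog.Triple.setReal {a : ℕ} {e f : IdxExp} {x : RealExp}
    (h : ∀ s, P s → Q (s.setReal a (e.eval s) (f.eval s) (x.eval s))) :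
    Prog.Triple slr T P (.setReal a e f x) Q (e.cost + f.cost + x.cost + 1) :=
  fun s hs => ⟨h s hs, le_rfl⟩

end Triple

/-! ### The program for `Q`-support recovery -/

namespace QRecovery

/-- Copy entry `(t, j)` of the design without column `i`. -/
def copyEntry : Prog :=
  .ifIdxLt (.reg 5) (.reg 3)
    (.setReal 3 (.reg 4) (.reg 5) (.get 0 (.reg 4) (.reg 5)))
    (.setReal 3 (.reg 4) (.reg 5) (.get 0 (.reg 4) (.add (.reg 5) (.const 1))))

/-- Copy row `t` of response and design. -/
def copyRow : Prog :=
  .seq (.setReal 2 (.reg 4) (.const 0) (.get 0 (.reg 4) (.reg 3)))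
    (.loop 5 (.sub (.reg 1) (.const 1)) copyEntry)

/-- Add one term to the inner product of row `t` with the estimate. -/
def addProduct : Prog :=
  .setReal 6 (.const 0) (.const 0) (.add (.get 6 (.const 0) (.const 0))
    (.mul (.get 3 (.reg 4) (.reg 5)) (.get 4 (.reg 5) (.const 0))))

/-- Add the contribution of row `t` to the statistic. -/
def addRow : Prog :=
  .seq (.setReal 6 (.const 0) (.const 0) (.ofIdx (.const 0)))
    (.seq (.loop 5 (.sub (.reg 1) (.const 1)) addProduct)
      (.setReal 5 (.const 0) (.const 0) (.add (.get 5 (.const 0) (.const 0))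
        (.sub (.mul (.get 2 (.reg 4) (.const 0)) (.get 2 (.reg 4) (.const 0)))
          (.mul (.sub (.get 2 (.reg 4) (.const 0)) (.get 6 (.const 0) (.const 0)))
            (.sub (.get 2 (.reg 4) (.const 0)) (.get 6 (.const 0) (.const 0))))))))

/-- Compare the statistic with the threshold. -/
def decideCoord : Prog :=
  .ifRealLt (.div (.mul (.mul (.ofIdx (.const 13)) (.ofIdx (.reg 2)))
      (.log (.div (.ofIdx (.reg 1)) (.ofIdx (.reg 2))))) (.ofIdx (.reg 0)))
    (.div (.get 5 (.const 0) (.const 0)) (.ofIdx (.reg 0)))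
    (.setReal 1 (.reg 3) (.const 0) (.ofIdx (.const 1)))
    (.setReal 1 (.reg 3) (.const 0) (.ofIdx (.const 0)))

/-- Process coordinate `i`. -/
def coordStep : Prog :=
  .seq (.loop 4 (.reg 0) copyRow)
    (.seq (.callSLR 4 2 3 (.reg 0) (.sub (.reg 1) (.const 1)) (.reg 2))
      (.seq (.setReal 5 (.const 0) (.const 0) (.ofIdx (.const 0)))
        (.seq (.loop 4 (.reg 0) addRow) decideCoord)))

/-- `Q`-support recovery. -/
def program : Prog := .loop 3 (.reg 1) coordStep

/-- The design entry `(t, j)` after deletion of column `i`. -/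
def dropEntry (D : ℕ → ℕ → ℝ) (i t j : ℕ) : ℝ := if j < i then D t j else D t (j + 1)

/-- The invariant part of the state while coordinate `i` is processed. -/
structure Frame (n p k : ℕ) (D A : ℕ → ℕ → ℝ) (i : ℕ) (s : MState) : Prop where
  idx0 : s.idx 0 = n
  idx1 : s.idx 1 = p + 1
  idx2 : s.idx 2 = k
  idx3 : s.idx 3 = i
  arr0 : s.arr 0 = D
  arr1 : s.arr 1 = A

variable {slr : SLRSolver} {T : ℕ → ℕ → ℕ → ℕ} {n p k i : ℕ} {D A : ℕ → ℕ → ℝ}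

/-- Registers 3, 4, 5 count coordinates, rows and columns. Array 1 is the output, 2 and 3 hold
response and reduced design, 4 the estimate, 5 the running statistic, 6 a running inner product.
Within one coordinate, `Frame` is disturbed only by the final write to array 1. -/
theorem Frame.setIdx {s : MState} (h : Frame n p k D A i s) {r : ℕ} (hr : 4 ≤ r) (x : ℕ) :
    Frame n p k D A i (s.setIdx r x) := by
  constructor <;> simp only [MState.setIdx]
  · rw [if_neg (by omega)]; exact h.idx0
  · rw [if_neg (by omega)]; exact h.idx1
  · rw [if_neg (by omega)]; exact h.idx2
  · rw [if_neg (by omega)]; exact h.idx3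
  · exact h.arr0
  · exact h.arr1

theorem Frame.setReal {s : MState} (h : Frame n p k D A i s) {a : ℕ} (ha : 2 ≤ a) (x y : ℕ)
    (z : ℝ) : Frame n p k D A i (s.setReal a x y z) := by
  constructor <;> simp only [MState.setReal]
  · exact h.idx0
  · exact h.idx1
  · exact h.idx2
  · exact h.idx3
  · ext b c; rw [if_neg (by omega), h.arr0]
  · ext b c; rw [if_neg (by omega), h.arr1]

/-- The first `t` rows have been copied. -/
def Copied (n p k : ℕ) (D A : ℕ → ℕ → ℝ) (i t : ℕ) (s : MState) : Prop :=
  Frame n p k D A i s ∧ (∀ t' < t, s.arr 2 t' 0 = D t' i) ∧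
    ∀ t' < t, ∀ j < p, s.arr 3 t' j = dropEntry D i t' j

/-- The branch on `j < i` realizes `Fin.succAbove`: columns from i on are shifted by one. -/
theorem triple_copyEntry {t j : ℕ} (hj : j < p) :
    Prog.Triple slr T (fun s => (Copied n p k D A i t s ∧ s.idx 4 = t ∧ s.arr 2 t 0 = D t i ∧
      ∀ j' < j, s.arr 3 t j' = dropEntry D i t j') ∧ s.idx 5 = j) copyEntry
      (fun s => Copied n p k D A i t s ∧ s.idx 4 = t ∧ s.arr 2 t 0 = D t i ∧
        ∀ j' < j + 1, s.arr 3 t j' = dropEntry D i t j') 20 := by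
  rintro s ⟨⟨⟨hF, h2, h3⟩, h4, h5, h6⟩, h7⟩
  have key : ∀ z : ℝ, z = dropEntry D i t j →
      Copied n p k D A i t (s.setReal 3 t j z) ∧ (s.setReal 3 t j z).idx 4 = t ∧
      (s.setReal 3 t j z).arr 2 t 0 = D t i ∧
        ∀ j' < j + 1, (s.setReal 3 t j z).arr 3 t j' = dropEntry D i t j' := by
    intro z hz
    refine ⟨⟨hF.setReal (by norm_num) _ _ _, fun t' ht' => ?_, fun t' ht' j' hj' => ?_⟩, h4, ?_,
      fun j' hj' => ?_⟩
    · simpa [MState.setReal] using h2 t' ht'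
    · simpa [MState.setReal, ht'.ne] using h3 t' ht' j' hj'
    · simpa [MState.setReal] using h5
    · rcases Nat.lt_succ_iff_lt_or_eq.1 hj' with h | rfl
      · simpa [MState.setReal, h.ne] using h6 j' h
      · simpa [MState.setReal] using hz
  by_cases hlt : j < i
  · have hd : s.arr 0 t j = dropEntry D i t j := by rw [hF.arr0, dropEntry, if_pos hlt]
    simpa [copyEntry, Prog.run, IdxExp.eval, RealExp.eval, IdxExp.cost, RealExp.cost, h4, h7,
      hF.idx3, hlt] using key _ hd
  · have hd : s.arr 0 t (j + 1) = dropEntry D i t j := by rw [hF.arr0, dropEntry, if_neg hlt]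
    simpa [copyEntry, Prog.run, IdxExp.eval, RealExp.eval, IdxExp.cost, RealExp.cost, h4, h7,
      hF.idx3, hlt] using key _ hd

theorem triple_copyRow {t : ℕ} :
    Prog.Triple slr T (fun s => Copied n p k D A i t s ∧ s.idx 4 = t) copyRow
      (Copied n p k D A i (t + 1)) (21 * p + 20) := by
  have hset : Prog.Triple slr T (fun s => Copied n p k D A i t s ∧ s.idx 4 = t)
      (.setReal 2 (.reg 4) (.const 0) (.get 0 (.reg 4) (.reg 3)))
      (fun s => Copied n p k D A i t s ∧ s.idx 4 = t ∧ s.arr 2 t 0 = D t i ∧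
        ∀ j' < 0, s.arr 3 t j' = dropEntry D i t j') 10 := by
    refine (Prog.Triple.setReal ?_).mono (by simp [IdxExp.cost, RealExp.cost])
    rintro s ⟨⟨hF, h2, h3⟩, h4⟩
    refine ⟨⟨hF.setReal (by norm_num) _ _ _, fun t' ht' => ?_, fun t' ht' j' hj' => ?_⟩, h4, ?_,
      by simp⟩
    · simpa [MState.setReal, IdxExp.eval, h4, ht'.ne] using h2 t' ht'
    · simpa [MState.setReal] using h3 t' ht' j' hj'
    · simp [MState.setReal, IdxExp.eval, RealExp.eval, h4, hF.idx3, hF.arr0]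
  have hloop := Prog.Triple.loop (slr := slr) (T := T) (r := 5) (c := copyEntry)
    (e := .sub (.reg 1) (.const 1)) (M := p) (K := 20)
    (I := fun j s => Copied n p k D A i t s ∧ s.idx 4 = t ∧ s.arr 2 t 0 = D t i ∧
      ∀ j' < j, s.arr 3 t j' = dropEntry D i t j')
    (fun s hs => by simp [IdxExp.eval, hs.1.1.idx1])
    (fun m x s hs => ⟨⟨hs.1.1.setIdx (by norm_num) x, hs.1.2⟩, by
      simpa [MState.setIdx] using hs.2.1, hs.2.2⟩)
    (fun m hm => triple_copyEntry hm)
  intro s hs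
  obtain ⟨⟨⟨hF, h2, h3⟩, h4, h5, h6⟩, hcost⟩ := (hset.seq hloop) s hs
  refine ⟨⟨hF, fun t' ht' => ?_, fun t' ht' => ?_⟩, hcost.trans ?_⟩
  · rcases Nat.lt_succ_iff_lt_or_eq.1 ht' with h | rfl
    · exact h2 t' h
    · exact h5
  · rcases Nat.lt_succ_iff_lt_or_eq.1 ht' with h | rfl
    · exact h3 t' h
    · exact h6
  · simp only [IdxExp.cost]; omega

/-- The estimate returned by the black box for coordinate `i`, extended by `0`. -/
noncomputable def estimate (slr : SLRSolver) (n p k : ℕ) (D : ℕ → ℕ → ℝ) (i j : ℕ) : ℝ :=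
  if h : j < p then slr n p (fun t => D t i) (Matrix.of fun t j => dropEntry D i t j) k ⟨j, h⟩
  else 0

/-- The prediction in row `t`, restricted to the first `m` columns. -/
noncomputable def partialPred (slr : SLRSolver) (n p k : ℕ) (D : ℕ → ℕ → ℝ) (i t m : ℕ) : ℝ :=
  ∑ j ∈ Finset.range m, dropEntry D i t j * estimate slr n p k D i j

/-- The contribution of the first `m` rows to the statistic. -/
noncomputable def partialStat (slr : SLRSolver) (n p k : ℕ) (D : ℕ → ℕ → ℝ) (i m : ℕ) : ℝ :=
  ∑ t ∈ Finset.range m, (D t i * D t i - (D t i - partialPred slr n p k D i t p) *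
    (D t i - partialPred slr n p k D i t p))

/-- The black box has been called. -/
def Called (slr : SLRSolver) (n p k : ℕ) (D A : ℕ → ℕ → ℝ) (i : ℕ) (s : MState) : Prop :=
  Copied n p k D A i n s ∧ ∀ j < p, s.arr 4 j 0 = estimate slr n p k D i j

theorem Called.setIdx {s : MState} (h : Called slr n p k D A i s) {r : ℕ} (hr : 4 ≤ r) (x : ℕ) :
    Called slr n p k D A i (s.setIdx r x) :=
  ⟨⟨h.1.1.setIdx hr x, h.1.2⟩, h.2⟩

theorem Called.setReal {s : MState} (h : Called slr n p k D A i s) {a : ℕ} (ha : 5 ≤ a) (x y : ℕ)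
    (z : ℝ) : Called slr n p k D A i (s.setReal a x y z) := by
  obtain ⟨⟨hF, h2, h3⟩, h4⟩ := h
  refine ⟨⟨hF.setReal (by omega) _ _ _, fun t ht => ?_, fun t ht j hj => ?_⟩, fun j hj => ?_⟩ <;>
    simp only [MState.setReal] <;> rw [if_neg (by omega)]
  · exact h2 t ht
  · exact h3 t ht j hj
  · exact h4 j hj

/-- The call reads only n rows and p columns, where the copied arrays agree with the intended
instance; stale entries elsewhere do not matter. -/
theorem triple_call :
    Prog.Triple slr T (Copied n p k D A i n)
      (.callSLR 4 2 3 (.reg 0) (.sub (.reg 1) (.const 1)) (.reg 2))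
      (Called slr n p k D A i) (T p n k + 6) := by
  rintro s ⟨hF, h2, h3⟩
  have e0 : (IdxExp.reg 0).eval s = n := hF.idx0
  have e1 : (IdxExp.sub (.reg 1) (.const 1)).eval s = p := by simp [IdxExp.eval, hF.idx1]
  have e2 : (IdxExp.reg 2).eval s = k := hF.idx2
  simp only [Prog.run]
  rw [e0, e1, e2]
  have hy : (fun t : Fin n => s.arr 2 t 0) = fun t : Fin n => D t i := by
    ext t; exact h2 t t.2
  have hX : (Matrix.of fun (t : Fin n) (j : Fin p) => s.arr 3 t j) =
      Matrix.of fun (t : Fin n) (j : Fin p) => dropEntry D i t j := by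
    ext t j; exact h3 t t.2 j j.2
  rw [hy, hX]
  refine ⟨⟨⟨⟨hF.idx0, hF.idx1, hF.idx2, hF.idx3, ?_, ?_⟩, fun t ht => ?_, fun t ht j hj => ?_⟩,
    fun j hj => ?_⟩, by simp [IdxExp.cost]⟩
  · ext b c; simp [MState.setVec, hF.arr0]
  · ext b c; simp [MState.setVec, hF.arr1]
  · simpa [MState.setVec] using h2 t ht
  · simpa [MState.setVec] using h3 t ht j hj
  · simp [MState.setVec, estimate, hj]

theorem triple_addProduct {t m : ℕ} (ht : t < n) (hm : m < p) :
    Prog.Triple slr T (fun s => (Called slr n p k D A i s ∧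
      s.arr 5 0 0 = partialStat slr n p k D i t ∧ s.idx 4 = t ∧
      s.arr 6 0 0 = partialPred slr n p k D i t m) ∧ s.idx 5 = m) addProduct
      (fun s => Called slr n p k D A i s ∧ s.arr 5 0 0 = partialStat slr n p k D i t ∧
        s.idx 4 = t ∧ s.arr 6 0 0 = partialPred slr n p k D i t (m + 1)) 20 := by
  refine (Prog.Triple.setReal ?_).mono (by simp [IdxExp.cost, RealExp.cost])
  rintro s ⟨⟨hC, h5, h4, h6⟩, hm5⟩
  refine ⟨hC.setReal (by norm_num) _ _ _, by simpa [MState.setReal] using h5, h4, ?_⟩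
  rw [partialPred, Finset.sum_range_succ, ← partialPred, ← h6, ← hC.1.2.2 t ht m hm, ← hC.2 m hm]
  simp [MState.setReal, IdxExp.eval, RealExp.eval, h4, hm5]

theorem triple_addRow {t : ℕ} (ht : t < n) :
    Prog.Triple slr T (fun s => (Called slr n p k D A i s ∧
      s.arr 5 0 0 = partialStat slr n p k D i t) ∧ s.idx 4 = t) addRow
      (fun s => Called slr n p k D A i s ∧ s.arr 5 0 0 = partialStat slr n p k D i (t + 1))
      (21 * p + 60) := by
  have hset : Prog.Triple slr T (fun s => (Called slr n p k D A i s ∧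
      s.arr 5 0 0 = partialStat slr n p k D i t) ∧ s.idx 4 = t)
      (.setReal 6 (.const 0) (.const 0) (.ofIdx (.const 0)))
      (fun s => Called slr n p k D A i s ∧ s.arr 5 0 0 = partialStat slr n p k D i t ∧
        s.idx 4 = t ∧ s.arr 6 0 0 = partialPred slr n p k D i t 0) 10 := by
    refine (Prog.Triple.setReal ?_).mono (by simp [IdxExp.cost, RealExp.cost])
    rintro s ⟨⟨hC, h5⟩, h4⟩
    refine ⟨hC.setReal (by norm_num) _ _ _, by simpa [MState.setReal] using h5, h4, ?_⟩
    simp [MState.setReal, IdxExp.eval, RealExp.eval, partialPred]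
  have hloop := Prog.Triple.loop (slr := slr) (T := T) (r := 5) (c := addProduct)
    (e := .sub (.reg 1) (.const 1)) (M := p) (K := 20)
    (I := fun m s => Called slr n p k D A i s ∧ s.arr 5 0 0 = partialStat slr n p k D i t ∧
      s.idx 4 = t ∧ s.arr 6 0 0 = partialPred slr n p k D i t m)
    (fun s hs => by simp [IdxExp.eval, hs.1.1.1.idx1])
    (fun m x s hs => ⟨hs.1.setIdx (by norm_num) x, hs.2.1, by
      simpa [MState.setIdx] using hs.2.2.1, hs.2.2.2⟩)
    (fun m hm => triple_addProduct ht hm)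
  refine (hset.seq (hloop.seq ((Prog.Triple.setReal ?_).mono (K' := 40) ?_))).mono ?_
  · rintro s ⟨hC, h5, h4, h6⟩
    refine ⟨hC.setReal (by norm_num) _ _ _, ?_⟩
    rw [partialStat, Finset.sum_range_succ, ← partialStat, ← h5, ← h6, ← hC.1.2.1 t ht]
    simp [MState.setReal, IdxExp.eval, RealExp.eval, h4]
  · simp [IdxExp.cost, RealExp.cost]
  · simp only [IdxExp.cost]; omega

/-- The decision for coordinate `i`. -/
noncomputable def Selected (slr : SLRSolver) (n p k : ℕ) (D : ℕ → ℕ → ℝ) (i : ℕ) : Prop :=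
  13 * k * Real.log (((p + 1 : ℕ) : ℝ) / k) / n < partialStat slr n p k D i n / n

open Classical in
/-- The first `m` coordinates have been decided. -/
def Decided (slr : SLRSolver) (n p k : ℕ) (D : ℕ → ℕ → ℝ) (m : ℕ) (s : MState) : Prop :=
  s.idx 0 = n ∧ s.idx 1 = p + 1 ∧ s.idx 2 = k ∧ s.arr 0 = D ∧
    ∀ i < m, s.arr 1 i 0 = if Selected slr n p k D i then 1 else 0

/-- A is the output array before the write. Either branch changes only entry m of column 0, so
earlier decisions persist. -/
theorem triple_decideCoord {m : ℕ} :
    Prog.Triple slr T (fun s => ∃ A, (∀ i < m, A i 0 = open Classical in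
        if Selected slr n p k D i then (1 : ℝ) else 0) ∧
      Called slr n p k D A m s ∧ s.arr 5 0 0 = partialStat slr n p k D m n)
      decideCoord (Decided slr n p k D (m + 1)) 40 := by
  rintro s ⟨A, hA, ⟨⟨hF, -, -⟩, -⟩, h5⟩
  have key : ∀ z : ℝ, z = (open Classical in if Selected slr n p k D m then (1 : ℝ) else 0) →
      Decided slr n p k D (m + 1) (s.setReal 1 m 0 z) := by
    intro z hz
    refine ⟨hF.idx0, hF.idx1, hF.idx2, ?_, fun i hi => ?_⟩
    · ext b c; simp [MState.setReal, hF.arr0]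
    · rcases Nat.lt_succ_iff_lt_or_eq.1 hi with h | rfl
      · simpa [MState.setReal, h.ne, hF.arr1] using hA i h
      · simpa [MState.setReal] using hz
  by_cases hS : Selected slr n p k D m
  · have hS' := hS
    rw [Selected] at hS'
    push_cast at hS'
    simpa [decideCoord, Prog.run, IdxExp.eval, RealExp.eval, IdxExp.cost, RealExp.cost,
      hF.idx0, hF.idx1, hF.idx2, hF.idx3, h5, hS'] using key 1 (by simp [hS])
  · have hS' := hS
    rw [Selected] at hS'
    push_cast at hS'
    simpa [decideCoord, Prog.run, IdxExp.eval, RealExp.eval, IdxExp.cost, RealExp.cost,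
      hF.idx0, hF.idx1, hF.idx2, hF.idx3, h5, hS'] using key 0 (by simp [hS])

theorem triple_coordStep (hn : 1 ≤ n) {m : ℕ} :
    Prog.Triple slr T (fun s => Decided slr n p k D m s ∧ s.idx 3 = m) coordStep
      (Decided slr n p k D (m + 1)) (T p n k + 200 * (n * (p + 1))) := by
  rintro s ⟨⟨h0, h1, h2, h3, h4⟩, h5⟩
  have hcopy := Prog.Triple.loop (slr := slr) (T := T) (r := 4) (c := copyRow) (e := .reg 0)
    (M := n) (K := 21 * p + 20) (I := fun t s' => Copied n p k D (s.arr 1) m t s')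
    (fun s' hs' => hs'.1.idx0) (fun t x s' hs' => ⟨hs'.1.setIdx (by norm_num) x, hs'.2⟩)
    (fun t _ => triple_copyRow)
  have hzero : Prog.Triple slr T (Called slr n p k D (s.arr 1) m)
      (.setReal 5 (.const 0) (.const 0) (.ofIdx (.const 0)))
      (fun s' => Called slr n p k D (s.arr 1) m s' ∧
        s'.arr 5 0 0 = partialStat slr n p k D m 0) 10 := by
    refine (Prog.Triple.setReal ?_).mono (by simp [IdxExp.cost, RealExp.cost])
    intro s' hs'
    refine ⟨hs'.setReal (by norm_num) _ _ _, ?_⟩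
    simp [MState.setReal, IdxExp.eval, RealExp.eval, partialStat]
  have hadd := Prog.Triple.loop (slr := slr) (T := T) (r := 4) (c := addRow) (e := .reg 0)
    (M := n) (K := 21 * p + 60) (I := fun t s' => Called slr n p k D (s.arr 1) m s' ∧
        s'.arr 5 0 0 = partialStat slr n p k D m t)
    (fun s' hs' => hs'.1.1.1.idx0) (fun t x s' hs' => ⟨hs'.1.setIdx (by norm_num) x, hs'.2⟩)
    (fun t ht => triple_addRow ht)
  have hdec : Prog.Triple slr T (fun s' => Called slr n p k D (s.arr 1) m s' ∧
      s'.arr 5 0 0 = partialStat slr n p k D m n) decideCoord (Decided slr n p k D (m + 1)) 40 :=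
    fun s' hs' => triple_decideCoord s' ⟨s.arr 1, h4, hs'⟩
  refine ((hcopy.seq (triple_call.seq (hzero.seq (hadd.seq hdec)))).mono ?_) s
    ⟨⟨h0, h1, h2, h5, h3, rfl⟩, by simp, by simp⟩
  -- The cost besides `T p n k` is linear in `n * (p + 1)` up to an additive constant, which `1 ≤ n`
  -- absorbs.
  simp only [IdxExp.cost]
  nlinarith

/-- The program sums the difference of squares row by row and divides by n once at the end; this
identifies the result with the difference of two normalized norms. -/
theorem partialStat_eq (slr : SLRSolver) (X : Matrix (Fin n) (Fin (p + 1)) ℝ) (k : ℕ)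
    (i : Fin (p + 1)) :
    partialStat slr n p k ((initState X k).arr 0) i n / n = qStat slr X k i := by
  have hD : ∀ (t : Fin n) (j : Fin (p + 1)), (initState X k).arr 0 t j = X t j := by
    intro t j
    simp only [initState]
    rw [dif_pos ⟨trivial, t.2, j.2⟩]
  have hdrop : ∀ (t : Fin n) (j : Fin p), dropEntry ((initState X k).arr 0) i t j =
      dropCol X i t j := by
    intro t j
    rw [dropEntry, dropCol, Matrix.submatrix_apply, ← hD, id]
    by_cases h : (j : ℕ) < i
    · rw [if_pos h, Fin.succAbove_of_castSucc_lt _ _ h]; rfl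
    · rw [if_neg h, Fin.succAbove_of_le_castSucc _ _ (not_lt.1 h)]; rfl
  have hy : (fun t : Fin n => (initState X k).arr 0 t i) = X.col i := by
    ext t; exact hD t i
  have hX : (Matrix.of fun (t : Fin n) (j : Fin p) => dropEntry ((initState X k).arr 0) i t j) =
      dropCol X i := by
    ext t j; exact hdrop t j
  have hest : ∀ j : Fin p, estimate slr n p k ((initState X k).arr 0) i j =
      slr n p (X.col i) (dropCol X i) k j := by
    intro j
    rw [estimate, dif_pos j.2, hy, hX]
  have hpred : ∀ t : Fin n, partialPred slr n p k ((initState X k).arr 0) i t p =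
      (dropCol X i *ᵥ slr n p (X.col i) (dropCol X i) k) t := by
    intro t
    rw [partialPred, Finset.sum_range]
    simp only [hest, hdrop]
    rfl
  rw [partialStat, Finset.sum_range, qStat, ← sub_div, Finset.sum_sub_distrib]
  simp only [hpred, hD, sqNorm, Matrix.col_apply, Pi.sub_apply, pow_two]

theorem program_spec (slr : SLRSolver) (T : ℕ → ℕ → ℕ → ℕ) (hn : 1 ≤ n)
    (X : Matrix (Fin n) (Fin (p + 1)) ℝ) (k : ℕ) :
    (program.run slr T (initState X k)).1.Outputs (qSupport slr X k) ∧
      (program.run slr T (initState X k)).2 ≤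
        300 * ((p + 1) * T p n k + (p + 1) ^ 2 * n) := by
  have h := Prog.Triple.loop (slr := slr) (T := T) (r := 3) (c := coordStep) (e := .reg 1)
    (M := p + 1) (K := T p n k + 200 * (n * (p + 1)))
    (I := Decided slr n p k ((initState X k).arr 0))
    (fun s hs => hs.2.1)
    (fun m x s hs => by simpa [Decided, MState.setIdx] using hs)
    (fun m _ => triple_coordStep hn)
  obtain ⟨⟨-, -, -, -, h1⟩, h2⟩ := h (initState X k)
    ⟨by simp [initState], by simp [initState], by simp [initState], rfl, by simp⟩
  refine ⟨fun i => ?_, h2.trans ?_⟩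
  · rw [program, h1 i i.2]
    simp only [Selected, partialStat_eq]
    simp [qSupport]
  · simp only [IdxExp.cost]
    nlinarith [Nat.zero_le (p * T p n k), Nat.zero_le (p * n), Nat.zero_le (p ^ 2 * n)]

end QRecovery

theorem theorem2 :
    -- success probability of `Q`-support recovery (the dimension is `d = p + 1`)
    (∀ c c' c'' : ℝ, 0 < c → 0 < c' → 0 < c'' →
      ∃ c₁ c₂ c₃ c₄ : ℝ, 0 < c₁ ∧ 0 < c₂ ∧ 0 < c₃ ∧ 0 < c₄ ∧
        ∀ slr : SLRSolver, slr.IsMeasurable → slr.BlackBox c c' c'' →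
        ∀ (n p k : ℕ) (θ cmin ε : ℝ) (u : EuclideanSpace ℝ (Fin (p + 1))),
          0 < cmin → cmin < 1 →
          ‖u‖ = 1 → IsSparse k u → SpikeSpread k cmin u → SpikeMin k cmin u →
          Real.exp 1 * k ≤ ((p + 1 : ℕ) : ℝ) →
          0 < ε → (k : ℝ) ≤ ((p + 1 : ℕ) : ℝ) ^ (1 - ε) →
          0 < θ → θ ≤ 1 →
          c₁ / cmin ^ 2 * ((k : ℝ) ^ 2 * Real.log ((p + 1 : ℕ) : ℝ) / n) < θ ^ 2 →
          c₂ * k * Real.log ((p + 1 : ℕ) : ℝ) < n →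
          1 - c₃ * Real.exp (-(c₄ * ε) * k * Real.log ((p + 1 : ℕ) : ℝ)) ≤
            (spikedLaw n θ u).real {x | qSupport slr (dataMatrix x) k = suppF u}) ∧
    -- running time `O(d T + d² n)`
    (∃ (prog : Prog) (C : ℕ), ∀ (slr : SLRSolver) (T : ℕ → ℕ → ℕ → ℕ) (n p k : ℕ), 1 ≤ n →
      ∀ X : Matrix (Fin n) (Fin (p + 1)) ℝ,
        (prog.run slr T (initState X k)).1.Outputs (qSupport slr X k) ∧
        (prog.run slr T (initState X k)).2 ≤ C * ((p + 1) * T p n k + (p + 1) ^ 2 * n)) := by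
  refine ⟨fun c c' c'' hc hc' hc'' => ⟨8 * (220 + 128 * c), 22 * 1034, 3 + c' * (4 / c''),
    min 1 (c'' / 4), by positivity, by norm_num, by positivity, by positivity, ?_⟩,
    QRecovery.program, 300, fun slr T n p k hn X => QRecovery.program_spec slr T hn X k⟩
  intro slr hm hs n p k θ cmin ε u hcmin _ hu husp hspread hmin hd hε hkε hθ hθ1 hsig hn
  exact support_recovery_real hc hc' hc'' hm hs hcmin hu husp hspread hmin hd hε hkε hθ hθ1 hsig hn
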